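/- Let $s$ be the Fréchet space of rapidly decreasing complex sequences, with the norms $|\xi|_n=\big(\sum_{j\ge1}|\xi_j|^2j^{2n}\big)^{1/2}$, $n\in\mathbb N_0$, let $s'$ be its strong dual, and let $\mathcal S=\mathcal L(s',s)$ be the noncommutative Schwartz space, i.e. the continuous linear operators $s'\to s$ with the topology of uniform convergence on bounded sets and with the multiplication $xy=x\circ\iota\circ y$, where $\iota\colon s\hookrightarrow s'$ is the inclusion of sequences, $\langle \eta,\iota\xi\rangle=\sum_j\xi_j\eta_j$. Let $\mathcal{MS}$ be the multiplier algebra of $\mathcal S$: the space of all double centralizers, i.e. pairs $(L,R)$ of maps $\mathcal S\to\mathcal S$ with $x\,L(y)=R(x)\,y$ for all $x,y\in\mathcal S$, with the topology of uniform convergence of $L$ and $R$ on the bounded subsets of $\mathcal S$. A PLS-space is a locally convex space $X$ that is (linearly homeomorphic to) a projective limit $\operatorname{proj}_{N\in\mathbb N_0}X_N$ of LS-spaces $X_N=\operatorname{ind}_{n\in\mathbb N_0}X_{N,n}$, where the $X_{N,n}$ are Banach spaces with compact linear inclusions $X_{N,n}\hookrightarrow X_{N,n+1}$. Write $\iota_N^M\colon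 X_M\to X_N$ $(N\le M)$ for the linking maps; the spectrum is taken to be reduced, i.e. $X$ has dense image in every $X_N$. For $x'\in X_N'$ let $\|x'\|^*_{N,n}=\sup\{|x'(x)|:x\in X_{N,n},\ \|x\|_{X_{N,n}}\le1\}$. The space $X$ has the dual interpolation estimate for big $\theta$ if it has such a spectrum with $$\forall N\ \exists M\ge N\ \forall K\ge N\ \exists n\ \forall m\ \exists\theta_0\in(0,1)\ \forall\theta\in[\theta_0,1)\ \exists k\ \exists C>0\ \forall x'\in X_N':\quad \|x'\circ\iota_N^M\|^*_{M,m}\le C\big(\|x'\circ\iota_N^K\|^*_{K,k}\big)^{1-\theta}\big(\|x'\|^*_{N,n}\big)^{\theta},$$ and the dual interpolation estimate for small $\theta$ if it has such a spectrum satisfying the same condition with $\forall\theta\in(0,\theta_0]$ in place of $\forall\theta\in[\theta_0,1)$. **Proposition.** The multiplier algebra $\mathcal{MS}$ of the noncommutative Schwartz space is a PLS-space that has the dual interpolation estimate for big $\theta$, but it does not have the dual interpolation estimate for small $\theta$. -/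

import Mathlib

set_option maxSynthPendingDepth 3

open scoped ENNReal

noncomputable section

namespace NCSchwartz

/-! ### The space `s` of rapidly decreasing sequences

Sequences are indexed by `ℕ = {0, 1, 2, …}`; the entry with index `j` carries the weight `j + 1`. -/

/-- The sequence `((j + 1) ^ n * ξ j)_j`. -/
def weighted (n : ℕ) (ξ : ℕ → ℂ) : ℕ → ℂ := fun j => ((j : ℂ) + 1) ^ n * ξ j

/-- The rapidly decreasing sequences: `∑ j, |ξ j|² (j + 1) ^ (2 n) < ∞` for all `n`. -/
def rapidSubmodule : Submodule ℂ (ℕ → ℂ) where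
  carrier := {ξ | ∀ n : ℕ, Memℓp (weighted n ξ) 2}
  add_mem' := by
    intro ξ η hξ hη n
    have h : weighted n (ξ + η) = weighted n ξ + weighted n η := by
      funext j; simp [weighted, mul_add]
    rw [h]
    exact (hξ n).add (hη n)
  zero_mem' := by
    intro n
    have h : weighted n 0 = 0 := by
      funext j; simp [weighted]
    rw [h]
    exact zero_memℓp
  smul_mem' := by
    intro c ξ hξ n
    have h : weighted n (c • ξ) = c • weighted n ξ := by
      funext j; simp [weighted, mul_left_comm]
    rw [h]
    exact (hξ n).const_smul c

/-- The space `s`. -/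
def RapidSeq : Type := rapidSubmodule

namespace RapidSeq

instance : AddCommGroup RapidSeq := rapidSubmodule.addCommGroup

instance : Module ℂ RapidSeq := rapidSubmodule.module

/-- The `j`-th entry of a rapidly decreasing sequence. -/
def coord (ξ : RapidSeq) (j : ℕ) : ℂ := ξ.1 j

/-- The map `ξ ↦ ((j + 1) ^ n * ξ j)_j` from `s` to `ℓ²`, so that `‖toL2 n ξ‖` is the norm
`|ξ|_n = (∑ j, |ξ j|² (j + 1) ^ (2 n)) ^ (1 / 2)`. -/
def toL2 (n : ℕ) : RapidSeq →ₗ[ℂ] lp (fun _ : ℕ => ℂ) 2 where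
  toFun ξ := ⟨weighted n ξ.1, ξ.2 n⟩
  map_add' ξ η := by
    ext j
    exact mul_add _ _ _
  map_smul' c ξ := by
    ext j
    exact mul_left_comm _ _ _

/-- All the maps `toL2 n` together. -/
def toProd : RapidSeq →ₗ[ℂ] (ℕ → lp (fun _ : ℕ => ℂ) 2) := LinearMap.pi toL2

/-- The Fréchet space structure of `s`, given by the norms `|·|_n`, `n ∈ ℕ`. -/
instance : UniformSpace RapidSeq := UniformSpace.comap toProd inferInstance

instance : IsUniformAddGroup RapidSeq := IsUniformAddGroup.comap toProd

lemma isInducing_toProd : Topology.IsInducing toProd := ⟨rfl⟩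

instance : ContinuousSMul ℂ RapidSeq :=
  isInducing_toProd.continuousSMul continuous_id (fun {c x} => map_smul toProd c x)

/-- `toL2 n` as a continuous linear map. -/
def toL2L (n : ℕ) : RapidSeq →L[ℂ] lp (fun _ : ℕ => ℂ) 2 :=
  ⟨toL2 n, (continuous_apply n).comp isInducing_toProd.continuous⟩

end RapidSeq

/-- The strong dual `s'` of `s`. -/
abbrev SlowSeq : Type := StrongDual ℂ RapidSeq

/-- The bilinear pairing `(ξ, η) ↦ ∑ j, ξ j * η j` on `ℓ²`. -/
def pairL2 : lp (fun _ : ℕ => ℂ) 2 →L[ℂ] lp (fun _ : ℕ => ℂ) 2 →L[ℂ] ℂ :=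
  have hs : ∀ ξ η : lp (fun _ : ℕ => ℂ) 2, Summable fun j => ‖ξ j‖ * ‖η j‖ := fun ξ η =>
    lp.summable_mul (p := 2) (q := 2)
      (by rw [Real.holderConjugate_iff]; norm_num) ξ η
  have hc : ∀ ξ η : lp (fun _ : ℕ => ℂ) 2, Summable fun j => ξ j * η j := fun ξ η =>
    Summable.of_norm (by simpa only [norm_mul] using hs ξ η)
  LinearMap.mkContinuous₂
    (LinearMap.mk₂ ℂ (fun ξ η : lp (fun _ : ℕ => ℂ) 2 => ∑' j, ξ j * η j)
      (fun ξ ξ' η => by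
        rw [← (hc ξ η).tsum_add (hc ξ' η)]
        exact tsum_congr fun j => add_mul _ _ _)
      (fun c ξ η => by
        rw [smul_eq_mul, ← tsum_mul_left]
        exact tsum_congr fun j => mul_assoc _ _ _)
      (fun ξ η η' => by
        rw [← (hc ξ η).tsum_add (hc ξ η')]
        exact tsum_congr fun j => mul_add _ _ _)
      (fun c ξ η => by
        rw [smul_eq_mul, ← tsum_mul_left]
        exact tsum_congr fun j => mul_left_comm _ _ _))
    1 (fun ξ η => by
      rw [one_mul]
      refine le_trans (norm_tsum_le_tsum_norm
        (by simpa only [norm_mul] using hs ξ η)) ?_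
      simp only [norm_mul]
      exact lp.tsum_mul_le_mul_norm' (p := 2) (q := 2)
        (by rw [Real.holderConjugate_iff]; norm_num) ξ η)

/-- The inclusion of `s` into `s'`: the sequence `ξ` acts on `s` as `η ↦ ∑ j, ξ j * η j`. -/
def incl : RapidSeq →L[ℂ] SlowSeq :=
  (ContinuousLinearMap.precomp ℂ (RapidSeq.toL2L 0)).comp (pairL2.comp (RapidSeq.toL2L 0))

lemma incl_apply (ξ η : RapidSeq) : incl ξ η = ∑' j, ξ.coord j * η.coord j := by
  change ∑' j : ℕ, (((j : ℂ) + 1) ^ 0 * ξ.1 j) * (((j : ℂ) + 1) ^ 0 * η.1 j) = _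
  simp [RapidSeq.coord]

/-! ### The noncommutative Schwartz space and its double centralizers -/

/-- The noncommutative Schwartz space `𝒮 = L(s', s)`, with the topology of uniform convergence
on the bounded subsets of `s'` (Mathlib's topology on spaces of continuous linear maps). -/
abbrev Smooth : Type := SlowSeq →L[ℂ] RapidSeq

/-- The product of `𝒮`: the composition `s' → s ⊆ s' → s`. -/
def opMul (x y : Smooth) : Smooth := x.comp (incl.comp y)

/-- The bounded subsets of `𝒮`. -/
def boundedSets : Set (Set Smooth) := {B | Bornology.IsVonNBounded ℂ B}

/-- The double centralizers of `𝒮`: the pairs `(L, R)` of arbitrary maps `𝒮 → 𝒮` such that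
`x L(y) = R(x) y` for all `x, y ∈ 𝒮`, with the pointwise operations. -/
def doubleCentralizers : Submodule ℂ ((Smooth → Smooth) × (Smooth → Smooth)) where
  carrier := {T | ∀ x y : Smooth, opMul x (T.1 y) = opMul (T.2 x) y}
  add_mem' := by
    intro T T' hT hT' x y
    have h1 : opMul x (T.1 y + T'.1 y) = opMul x (T.1 y) + opMul x (T'.1 y) := by
      simp [opMul, ContinuousLinearMap.comp_add]
    have h2 : opMul (T.2 x + T'.2 x) y = opMul (T.2 x) y + opMul (T'.2 x) y := by
      simp [opMul, ContinuousLinearMap.add_comp]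
    exact h1.trans ((congrArg₂ (· + ·) (hT x y) (hT' x y)).trans h2.symm)
  zero_mem' := by
    intro x y
    simp [opMul]
  smul_mem' := by
    intro c T hT x y
    have h1 : opMul x (c • T.1 y) = c • opMul x (T.1 y) := by
      simp [opMul]
    have h2 : opMul (c • T.2 x) y = c • opMul (T.2 x) y := by
      simp [opMul, ContinuousLinearMap.smul_comp]
    exact h1.trans ((congrArg (c • ·) (hT x y)).trans h2.symm)

/-- The multiplier algebra of `𝒮` as a topological vector space: the double centralizers
`(L, R)` of `𝒮`, with the topology of uniform convergence of `L` and of `R` on the bounded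
subsets of `𝒮`. -/
def MultiplierAlgebra : Type := doubleCentralizers

instance : AddCommGroup MultiplierAlgebra := doubleCentralizers.addCommGroup

instance : Module ℂ MultiplierAlgebra := doubleCentralizers.module

instance : TopologicalSpace MultiplierAlgebra :=
  TopologicalSpace.induced
    (fun T : doubleCentralizers =>
      (UniformOnFun.ofFun boundedSets T.1.1, UniformOnFun.ofFun boundedSets T.1.2))
    inferInstance

end NCSchwartz

/-! ### PLS-spaces and the dual interpolation estimate -/

/-- The locally convex inductive limit topology on `E` of a sequence of linear maps
`emb n : B n → E` from normed spaces: it is given by all the seminorms on `E` whose restrictions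
to the `B n` are continuous, and so is the finest locally convex topology for which every
`emb n` is continuous. -/
@[reducible]
def indTopology {B : ℕ → Type} [∀ n, NormedAddCommGroup (B n)] [∀ n, NormedSpace ℂ (B n)]
    {E : Type} [AddCommGroup E] [Module ℂ E] (emb : ∀ n, B n →ₗ[ℂ] E) : TopologicalSpace E :=
  haveI : Nonempty {p : Seminorm ℂ E // ∀ n, Continuous fun x => p (emb n x)} :=
    ⟨⟨0, fun _ => continuous_const⟩⟩
  (SeminormFamily.moduleFilterBasis (𝕜 := ℂ) (F := E)
    (fun p : {p : Seminorm ℂ E // ∀ n, Continuous fun x => p (emb n x)} => p.1)).topology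

/-- An LS-space `E = ind_n B n`: the union of an increasing sequence of Banach spaces `B n`
with compact inclusions, with the locally convex inductive limit topology. -/
structure LSSpace where
  B : ℕ → Type
  [normed : ∀ n, NormedAddCommGroup (B n)]
  [normedSpace : ∀ n, NormedSpace ℂ (B n)]
  [complete : ∀ n, CompleteSpace (B n)]
  E : Type
  [addCommGroup : AddCommGroup E]
  [module : Module ℂ E]
  link : ∀ n, B n →L[ℂ] B (n + 1)
  link_compact : ∀ n, IsCompactOperator (link n)
  emb : ∀ n, B n →ₗ[ℂ] E
  emb_injective : ∀ n, Function.Injective (emb n)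
  emb_link : ∀ n x, emb (n + 1) (link n x) = emb n x
  exists_emb : ∀ e : E, ∃ n x, emb n x = e

namespace LSSpace

attribute [instance] normed normedSpace complete addCommGroup module

instance (X : LSSpace) : TopologicalSpace X.E := indTopology X.emb

lemma continuous_emb (X : LSSpace) (n : ℕ) : Continuous (X.emb n) := by
  have : Nonempty {p : Seminorm ℂ X.E // ∀ n, Continuous fun x => p (X.emb n x)} :=
    ⟨⟨0, fun _ => continuous_const⟩⟩
  have hw : WithSeminorms (𝕜 := ℂ) (E := X.E)
      (fun p : {p : Seminorm ℂ X.E // ∀ n, Continuous fun x => p (X.emb n x)} => p.1) := ⟨rfl⟩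
  have := hw.topologicalAddGroup
  refine WithSeminorms.continuous_of_isBounded (norm_withSeminorms ℂ (X.B n)) hw _ ?_
  intro p
  have hc : Continuous (p.1.comp (X.emb n)) := p.2 n
  obtain ⟨t, C, -, h⟩ := Seminorm.bound_of_continuous (norm_withSeminorms ℂ (X.B n)) _ hc
  refine ⟨t, C, h⟩

/-- The inclusion of `B n` into `E` as a continuous linear map. -/
def embL (X : LSSpace) (n : ℕ) : X.B n →L[ℂ] X.E := ⟨X.emb n, X.continuous_emb n⟩

/-- The dual norm `‖φ‖*_n = sup {|φ x| : x ∈ B n, ‖x‖ ≤ 1}` of a continuous linear functional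
`φ` on `E`. -/
def dualNorm (X : LSSpace) (n : ℕ) (φ : X.E →L[ℂ] ℂ) : ℝ := ‖φ.comp (X.embL n)‖

end LSSpace

/-- A projective spectrum `(step N)_N` of LS-spaces with continuous linear linking maps
`ι_N^M : step M → step N` for `N ≤ M`. -/
structure PLSSpectrum where
  step : ℕ → LSSpace
  proj : ∀ {N M : ℕ}, N ≤ M → (step M).E →L[ℂ] (step N).E
  proj_refl : ∀ (N : ℕ) (x : (step N).E), proj (le_refl N) x = x
  proj_proj : ∀ {N M K : ℕ} (h : N ≤ M) (h' : M ≤ K) (x : (step K).E),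
    proj h (proj h' x) = proj (h.trans h') x

namespace PLSSpectrum

/-- The projective limit of the spectrum, with the topology induced by the product. -/
def limit (S : PLSSpectrum) : Submodule ℂ (∀ N, (S.step N).E) where
  carrier := {x | ∀ (N M : ℕ) (h : N ≤ M), S.proj h (x M) = x N}
  add_mem' := by
    intro x y hx hy N M h
    simp [hx N M h, hy N M h]
  zero_mem' := by
    intro N M h
    simp
  smul_mem' := by
    intro c x hx N M h
    simp [hx N M h]

/-- The spectrum is reduced: the projective limit is dense in every step. -/
def IsReduced (S : PLSSpectrum) : Prop :=
  ∀ N, DenseRange fun x : S.limit => x.1 N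

/-- The inequality
`‖x' ∘ ι_N^M‖*_{M,m} ≤ C (‖x' ∘ ι_N^K‖*_{K,k})^(1-θ) (‖x'‖*_{N,n})^θ` for all `x'` in the dual
of the `N`-th step. -/
def InterpolationInequality (S : PLSSpectrum) {N M K : ℕ} (hM : N ≤ M) (hK : N ≤ K)
    (n m k : ℕ) (θ C : ℝ) : Prop :=
  ∀ φ : (S.step N).E →L[ℂ] ℂ,
    (S.step M).dualNorm m (φ.comp (S.proj hM)) ≤
      C * (S.step K).dualNorm k (φ.comp (S.proj hK)) ^ (1 - θ) * (S.step N).dualNorm n φ ^ θ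

/-- The dual interpolation estimate for big `θ`, for a spectrum. -/
def DualInterpolationBig (S : PLSSpectrum) : Prop :=
  ∀ N : ℕ, ∃ (M : ℕ) (hM : N ≤ M), ∀ (K : ℕ) (hK : N ≤ K), ∃ n : ℕ, ∀ m : ℕ,
    ∃ θ₀ ∈ Set.Ioo (0 : ℝ) 1, ∀ θ ∈ Set.Ico θ₀ 1, ∃ (k : ℕ) (C : ℝ), 0 < C ∧
      S.InterpolationInequality hM hK n m k θ C

/-- The dual interpolation estimate for small `θ`, for a spectrum. -/
def DualInterpolationSmall (S : PLSSpectrum) : Prop :=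
  ∀ N : ℕ, ∃ (M : ℕ) (hM : N ≤ M), ∀ (K : ℕ) (hK : N ≤ K), ∃ n : ℕ, ∀ m : ℕ,
    ∃ θ₀ ∈ Set.Ioo (0 : ℝ) 1, ∀ θ ∈ Set.Ioc 0 θ₀, ∃ (k : ℕ) (C : ℝ), 0 < C ∧
      S.InterpolationInequality hM hK n m k θ C

/-- The spectrum is reduced and its projective limit is `X`, up to a linear homeomorphism. -/
def Represents (S : PLSSpectrum) (X : Type) [AddCommGroup X] [Module ℂ X]
    [TopologicalSpace X] : Prop :=
  S.IsReduced ∧ Nonempty (X ≃L[ℂ] S.limit)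

end PLSSpectrum

/-- `X` is a PLS-space with the dual interpolation estimate for big `θ`. Reduced spectra of
LS-spaces with the same projective limit are equivalent, so the choice of the spectrum is
immaterial. -/
def HasDualInterpolationBig (X : Type) [AddCommGroup X] [Module ℂ X]
    [TopologicalSpace X] : Prop :=
  ∃ S : PLSSpectrum, S.Represents X ∧ S.DualInterpolationBig

/-- `X` is a PLS-space with the dual interpolation estimate for small `θ`. -/
def HasDualInterpolationSmall (X : Type) [AddCommGroup X] [Module ℂ X]
    [TopologicalSpace X] : Prop :=
  ∃ S : PLSSpectrum, S.Represents X ∧ S.DualInterpolationSmall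

end

/-!
The double centralizers `(L, R)` of the noncommutative Schwartz space `𝒮` are identified with
infinite matrices `t` by `L y = t y` and `R x = x t` (`hasSum_entry_left`, `hasSum_entry_right`),
where `𝒮` itself is the space of rapidly decreasing matrices, with the topology given by the
norms `sup_{ij} (i + 1) ^ q (j + 1) ^ q |x i j|` (`withSeminorms_matNorm`). A matrix `t` occurs if
and only if for each `N` there is an `n` such that `|t i j| max(i, j) ^ N ≤ C min(i, j) ^ n`, with
`i + 1` and `j + 1` in place of `i` and `j`. So the multiplier algebra is, as a topological vector
space, the limit of the spectrum of the co-echelon spaces `ind_n ℓ¹(w N n)` with the weights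
`w N n = max(i, j) ^ (N + 1 / (n + 1)) min(i, j) ^ (-n)` (`multiplierWeight`, `limitEquivL`). The
summand `1 / (n + 1)` in the exponent is there to make the inclusions compact. The algebraic part
needs no closed graph theorem: a matrix in `𝒮` with a single entry in each column tests all the
estimates for `t` at once (`isColumnMultiplier_of_forall_isRapid`). For the topology, a continuous
seminorm on the step `N` is at most `max(i, j) ^ (N + 1)` times a rapidly decreasing function of
`min(i, j)` on the matrix units, and this function yields a bounded set of matrices in `𝒮` on which
the size of `L` and `R` controls the seminorm (`continuous_seminorm_comp_toLimit`).

In a weighted `ℓ¹`-space the dual norms are weighted suprema, so that the dual interpolation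
estimate reduces to an inequality between the weights
(`interpolationInequality_of_weights`). With `M = N + 2` and `n = 0` it amounts to
`(K + 1) (1 - θ) + (N + 1) θ ≤ N + 2` and `m ≤ k (1 - θ)`; this holds for `θ` close to `1` and large
`k` (`dualInterpolationBig_multiplierSpectrum`).

The estimate for small `θ` has to be refuted for every reduced spectrum with the same limit. The
functionals `f i` which take the entry `t i 0` come from functionals on one step `N`, because
`sup_i |f i|` is a continuous seminorm. On the step `M` given by the estimate, their dual norms for
some `m` are not `O((i + 1) ^ (-A))` for some `A`: otherwise a supremum of rapidly growing multiples
of the `|f i|` would be a continuous seminorm, whereas every continuous seminorm grows at most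
polynomially on the matrix units `E_{i0}`, where `f i` is `1`
(`LSSpace.exists_dualNorm_not_rapid`). On a step `K` so large that `sup_i (i + 1) ^ (2 A) |f i|` is
continuous there, all dual norms are `O((i + 1) ^ (-2 A))`. With `θ ≤ 1 / 2` this contradicts the
estimate (`PLSSpectrum.not_dualInterpolationSmall`).
-/

noncomputable section

open Filter Topology

/-! ### Continuous seminorms on LS-spaces and on limits of spectra -/

/-- The supremum of the moduli of a family of linear functionals. It is meaningful for pointwise
bounded families, see `iSupNorm_le_iff`. -/
def iSupNorm {E ι : Type*} [AddCommGroup E] [Module ℂ E] (g : ι → E →ₗ[ℂ] ℂ) : Seminorm ℂ E :=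
  ⨆ j, (normSeminorm ℂ ℂ).comp (g j)

section iSupNorm

variable {E ι : Type*} [AddCommGroup E] [Module ℂ E] [Nonempty ι] {g : ι → E →ₗ[ℂ] ℂ}

lemma iSupNorm_le_iff (h : ∀ x, ∃ c, ∀ j, ‖g j x‖ ≤ c) {x : E} {c : ℝ} :
    iSupNorm g x ≤ c ↔ ∀ j, ‖g j x‖ ≤ c := by
  have hb : BddAbove (Set.range fun j => (normSeminorm ℂ ℂ).comp (g j)) := by
    rw [Seminorm.bddAbove_range_iff]
    intro x
    obtain ⟨c, hc⟩ := h x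
    exact ⟨c, by rintro _ ⟨j, rfl⟩; exact hc j⟩
  rw [iSupNorm, Seminorm.iSup_apply hb]
  refine ciSup_le_iff ?_
  obtain ⟨c, hc⟩ := h x
  exact ⟨c, by rintro _ ⟨j, rfl⟩; exact hc j⟩

lemma norm_le_iSupNorm (h : ∀ x, ∃ c, ∀ j, ‖g j x‖ ≤ c) (j : ι) (x : E) :
    ‖g j x‖ ≤ iSupNorm g x :=
  (iSupNorm_le_iff h).1 le_rfl j

end iSupNorm

lemma norm_natCast_add_one_pow (i n : ℕ) : ‖((i : ℂ) + 1) ^ n‖ = ((i : ℝ) + 1) ^ n := by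
  rw [norm_pow, ← Nat.cast_add_one, Complex.norm_natCast, Nat.cast_add_one]

namespace LSSpace

variable (X : LSSpace)

lemma withSeminorms : WithSeminorms (𝕜 := ℂ) (E := X.E)
    (fun p : {p : Seminorm ℂ X.E // ∀ n, Continuous fun x => p (X.emb n x)} => p.1) := by
  have : Nonempty {p : Seminorm ℂ X.E // ∀ n, Continuous fun x => p (X.emb n x)} :=
    ⟨⟨0, fun _ => continuous_const⟩⟩
  exact ⟨rfl⟩

instance instPolynormableSpace : PolynormableSpace ℂ X.E := X.withSeminorms.toPolynormableSpace

instance instIsTopologicalAddGroup : IsTopologicalAddGroup X.E :=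
  X.withSeminorms.topologicalAddGroup

variable {X}

lemma continuous_seminorm_of_le {p : Seminorm ℂ X.E}
    (h : ∀ n, ∃ C : ℝ, ∀ x, p (X.emb n x) ≤ C * ‖x‖) : Continuous p := by
  refine X.withSeminorms.continuous_seminorm ⟨p, fun n => ?_⟩
  obtain ⟨C, hC⟩ := h n
  refine Seminorm.continuous_of_le (p := p.comp (X.emb n))
    (q := C.toNNReal • normSeminorm ℂ (X.B n)) ?_ ?_
  · exact continuous_norm.const_smul C.toNNReal
  · intro x
    refine (hC x).trans ?_
    exact mul_le_mul_of_nonneg_right (Real.le_coe_toNNReal C) (norm_nonneg x)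

lemma exists_seminorm_emb_le {p : Seminorm ℂ X.E} (hp : Continuous p) (n : ℕ) :
    ∃ C : ℝ, 0 ≤ C ∧ ∀ x, p (X.emb n x) ≤ C * ‖x‖ := by
  have hc : Continuous (p.comp (X.emb n)) := hp.comp (X.continuous_emb n)
  obtain ⟨C, hC, h⟩ := Seminorm.bound_of_continuous_normedSpace _ hc
  exact ⟨C, hC.le, h⟩

lemma dualNorm_nonneg (n : ℕ) (φ : X.E →L[ℂ] ℂ) : 0 ≤ X.dualNorm n φ := norm_nonneg _

lemma norm_emb_le_dualNorm (n : ℕ) (φ : X.E →L[ℂ] ℂ) (x : X.B n) :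
    ‖φ (X.emb n x)‖ ≤ X.dualNorm n φ * ‖x‖ :=
  (φ.comp (X.embL n)).le_opNorm x

lemma dualNorm_le {n : ℕ} {φ : X.E →L[ℂ] ℂ} {C : ℝ} (hC : 0 ≤ C)
    (h : ∀ x : X.B n, ‖φ (X.emb n x)‖ ≤ C * ‖x‖) : X.dualNorm n φ ≤ C :=
  ContinuousLinearMap.opNorm_le_bound _ hC h

/-- If functionals `ψ i` satisfy `ψ i (r i) = 1` at points `r i` that grow polynomially with
respect to each continuous seminorm, then some dual norm of the `ψ i` does not decay rapidly.
Otherwise a supremum of multiples of the `|ψ i|` growing faster than all powers of `i` would be a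
seminorm continuous on all steps of the inductive limit. -/
lemma exists_dualNorm_not_rapid (ψ : ℕ → X.E →L[ℂ] ℂ) (r : ℕ → X.E) (hψ : ∀ i, ψ i (r i) = 1)
    (hr : ∀ p : Seminorm ℂ X.E, Continuous p →
      ∃ (A : ℕ) (C : ℝ), ∀ i : ℕ, p (r i) ≤ C * ((i : ℝ) + 1) ^ A) :
    ∃ m A : ℕ, ∀ C : ℝ, ∃ i : ℕ, C < ((i : ℝ) + 1) ^ A * X.dualNorm m (ψ i) := by
  by_contra! hcon
  choose C hC using hcon
  have hi1 : ∀ i : ℕ, (0 : ℝ) < (i : ℝ) + 1 := fun i => by positivity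
  have hC0 : ∀ m A, 0 ≤ C m A := fun m A =>
    le_trans (mul_nonneg (pow_nonneg (hi1 0).le _) (dualNorm_nonneg _ _)) (hC m A 0)
  -- from the index `I k` on, `(i + 1) ^ k * ‖ψ i‖*_m ≤ 1` for all `m ≤ k`
  have hI : ∀ k : ℕ, ∃ I : ℕ, ∀ i ≥ I, ∀ m ≤ k,
      ((i : ℝ) + 1) ^ k * X.dualNorm m (ψ i) ≤ 1 := by
    intro k
    obtain ⟨I, hI⟩ := exists_nat_ge (∑ m ∈ Finset.range (k + 1), C m (k + 1))
    refine ⟨I, fun i hi m hm => ?_⟩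
    have h1 : C m (k + 1) ≤ (i : ℝ) + 1 := by
      have h2 : C m (k + 1) ≤ ∑ m ∈ Finset.range (k + 1), C m (k + 1) :=
        Finset.single_le_sum (f := fun m => C m (k + 1)) (fun j _ => hC0 j _)
          (Finset.mem_range.2 (by omega))
      have h3 : (I : ℝ) ≤ i := by exact_mod_cast hi
      linarith
    have h4 := (hC m (k + 1) i).trans h1
    rw [pow_succ', mul_assoc] at h4
    exact le_of_mul_le_mul_left (by simpa using h4) (hi1 i)
  choose I hI using hI
  -- the supremum is taken over the pairs `(k, i)` with `I k ≤ i`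
  let J : Type := {q : ℕ × ℕ // I q.1 ≤ q.2}
  have : Nonempty J := ⟨⟨(0, I 0), le_refl _⟩⟩
  let g : J → X.E →ₗ[ℂ] ℂ := fun q =>
    (((q.1.2 : ℂ) + 1) ^ q.1.1) • ((ψ q.1.2 : X.E →L[ℂ] ℂ) : X.E →ₗ[ℂ] ℂ)
  have hg : ∀ (q : J) x, ‖g q x‖ = ((q.1.2 : ℝ) + 1) ^ q.1.1 * ‖ψ q.1.2 x‖ := by
    intro q x
    exact (norm_mul _ _).trans (by rw [norm_natCast_add_one_pow]; rfl)
  have hbound : ∀ n, ∀ x : X.B n, ∀ q : J,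
      ‖g q (X.emb n x)‖ ≤ (1 + ∑ k ∈ Finset.range n, C n k) * ‖x‖ := by
    intro n x q
    rw [hg]
    refine (mul_le_mul_of_nonneg_left (norm_emb_le_dualNorm n (ψ q.1.2) x)
      (pow_nonneg (hi1 _).le _)).trans ?_
    rw [← mul_assoc]
    refine mul_le_mul_of_nonneg_right ?_ (norm_nonneg x)
    have hs : 0 ≤ ∑ k ∈ Finset.range n, C n k := Finset.sum_nonneg fun k _ => hC0 _ _
    by_cases hn : n ≤ q.1.1
    · exact (hI _ _ q.2 n hn).trans (by linarith)
    · refine (hC n q.1.1 q.1.2).trans ?_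
      have := Finset.single_le_sum (f := fun k => C n k) (fun j _ => hC0 n j)
          (Finset.mem_range.2 (not_le.1 hn))
      linarith
  have hfin : ∀ e, ∃ c, ∀ q, ‖g q e‖ ≤ c := fun e => by
    obtain ⟨n, x, rfl⟩ := X.exists_emb e
    exact ⟨_, hbound n x⟩
  have hpc : Continuous (iSupNorm g) :=
    continuous_seminorm_of_le fun n => ⟨_, fun x => (iSupNorm_le_iff hfin).2 (hbound n x)⟩
  obtain ⟨A, D, hD⟩ := hr _ hpc
  obtain ⟨i₀, hi₀⟩ := exists_nat_gt D
  let i := max i₀ (I (A + 1))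
  have h1 := (norm_le_iSupNorm hfin (⟨(A + 1, i), le_max_right _ _⟩ : J) (r i)).trans (hD i)
  rw [hg, hψ, norm_one, mul_one, pow_succ'] at h1
  have h2 := le_of_mul_le_mul_right h1 (pow_pos (hi1 i) A)
  have h3 : (i₀ : ℝ) ≤ i := by exact_mod_cast le_max_left _ _
  linarith

end LSSpace

namespace PLSSpectrum

variable (S : PLSSpectrum)

/-- Every continuous seminorm on the limit is dominated by one on a step. -/
lemma exists_step_seminorm_ge (q : Seminorm ℂ S.limit) (hq : Continuous q) (N₀ : ℕ) :
    ∃ N, N₀ ≤ N ∧ ∃ p : Seminorm ℂ (S.step N).E, Continuous p ∧ ∀ x : S.limit, q x ≤ p (x.1 N) := by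
  have hw := withSeminorms_pi (𝕜 := ℂ)
    (fun N => PolynormableSpace.withSeminorms ℂ (S.step N).E)
  obtain ⟨s, C, -, hs⟩ := Seminorm.bound_comp_of_isInducing hq hw
    (f := S.limit.subtype) Topology.IsInducing.subtypeVal
  suffices H : ∃ N, N₀ ≤ N ∧ ∃ p : Seminorm ℂ (S.step N).E, Continuous p ∧
      ∀ i ∈ s, ∀ x : S.limit, i.2.1 (x.1 i.1) ≤ p (x.1 N) by
    obtain ⟨N, hN, p, hp, h⟩ := H
    refine ⟨N, hN, C • p, hp.const_smul C, fun x => (hs x).trans ?_⟩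
    refine mul_le_mul_of_nonneg_left ?_ C.2
    exact Seminorm.finset_sup_apply_le (apply_nonneg p _) fun i hi => h i hi x
  clear hs
  classical
  induction s using Finset.induction_on with
  | empty => exact ⟨N₀, le_rfl, 0, continuous_const, by simp⟩
  | insert a s _ ih =>
    obtain ⟨N, hN, p, hp, h⟩ := ih
    refine ⟨max N a.1, hN.trans (le_max_left _ _),
      p.comp (S.proj (le_max_left N a.1)).toLinearMap ⊔
        a.2.1.comp (S.proj (le_max_right N a.1)).toLinearMap, ?_, ?_⟩
    · exact (hp.comp (S.proj _).continuous).sup (a.2.2.comp (S.proj _).continuous)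
    · intro i hi x
      have e1 := x.2 N _ (le_max_left N a.1)
      have e2 := x.2 a.1 _ (le_max_right N a.1)
      have h1 : p (x.1 N) ⊔ a.2.1 (x.1 a.1) ≤ (p.comp (S.proj (le_max_left N a.1)).toLinearMap ⊔
        a.2.1.comp (S.proj (le_max_right N a.1)).toLinearMap) (x.1 (max N a.1)) := by
        rw [Seminorm.sup_apply, Seminorm.comp_apply, Seminorm.comp_apply]
        exact le_of_eq (congrArg₂ (· ⊔ ·) (congrArg p e1.symm) (congrArg a.2.1 e2.symm))
      refine le_trans ?_ h1
      rcases Finset.mem_insert.1 hi with rfl | hi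
      · exact le_max_right _ _
      · exact (h i hi x).trans (le_max_left _ _)

/-- A linear functional on the limit dominated by a continuous seminorm on a step extends to a
continuous linear functional on that step. -/
lemma exists_extension {N : ℕ} (p : Seminorm ℂ (S.step N).E) (hp : Continuous p)
    (f : S.limit →ₗ[ℂ] ℂ) (hf : ∀ x : S.limit, ‖f x‖ ≤ p (x.1 N)) :
    ∃ φ : (S.step N).E →L[ℂ] ℂ, (∀ x : S.limit, φ (x.1 N) = f x) ∧ ∀ y, ‖φ y‖ ≤ p y := by
  let π : S.limit →ₗ[ℂ] (S.step N).E := (LinearMap.proj N).comp S.limit.subtype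
  -- `f` vanishes on the kernel of `π`, so that it is `f ∘ σ ∘ π` for any section `σ` of `π`
  obtain ⟨σ, hσ⟩ := π.rangeRestrict.exists_rightInverse_of_surjective π.range_rangeRestrict
  have hσ' : ∀ y, π (σ y) = y := fun y => congrArg Subtype.val (LinearMap.congr_fun hσ y)
  obtain ⟨φ, hφ, hφp⟩ := Module.Dual.exists_continuous_extension_of_le_seminorm
    (LinearMap.range π) (f.comp σ) hp (fun y => (hf (σ y)).trans (le_of_eq (congrArg p (hσ' y))))
  refine ⟨φ, fun x => ?_, hφp⟩
  refine (hφ (π.rangeRestrict x)).trans ?_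
  rw [← sub_eq_zero, ← norm_le_zero_iff, LinearMap.comp_apply, ← map_sub]
  refine (hf _).trans (le_of_eq ?_)
  have h0 : π (σ (π.rangeRestrict x) - x) = 0 := by
    rw [map_sub, sub_eq_zero]
    exact hσ' _
  exact (congrArg p h0).trans (map_zero p)

variable {S}

/-- Coordinate functionals `f i` for which all `sup i, (i + 1) ^ A * |f i|` are continuous
seminorms, with a dual system `r i` of polynomial growth, exclude the estimate for small `θ`:
the dual norms of `f i` on the step `M` do not decay faster than all powers of `i`, whereas
those on the step `K` decay faster than any prescribed power when `K` is large. -/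
theorem not_dualInterpolationSmall (hS : S.IsReduced) (f : ℕ → S.limit →ₗ[ℂ] ℂ)
    (r : ℕ → S.limit)
    (hf : ∀ A : ℕ, ∃ q : Seminorm ℂ S.limit, Continuous q ∧
      ∀ (i : ℕ) x, ((i : ℝ) + 1) ^ A * ‖f i x‖ ≤ q x)
    (hfr : ∀ i, f i (r i) = 1)
    (hr : ∀ q : Seminorm ℂ S.limit, Continuous q →
      ∃ (A : ℕ) (C : ℝ), ∀ i : ℕ, q (r i) ≤ C * ((i : ℝ) + 1) ^ A) :
    ¬ S.DualInterpolationSmall := by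
  intro hD
  have hi1 : ∀ i : ℕ, (1 : ℝ) ≤ (i : ℝ) + 1 := fun i => by
    have : (0 : ℝ) ≤ i := i.cast_nonneg
    linarith
  have hi0 : ∀ i : ℕ, (0 : ℝ) < (i : ℝ) + 1 := fun i => by positivity
  -- all the `f i` come from functionals `φ i` on the same step `N`
  obtain ⟨q, hq, hqf⟩ := hf 0
  obtain ⟨N, -, p, hp, hqp⟩ := S.exists_step_seminorm_ge q hq 0
  have hfp : ∀ i x, ‖f i x‖ ≤ p (x.1 N) := fun i x => by
    have := (hqf i x).trans (hqp x)
    simpa using this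
  choose φ hφ hφp using fun i => S.exists_extension p hp (f i) (hfp i)
  obtain ⟨M, hM, hD⟩ := hD N
  have hlow := LSSpace.exists_dualNorm_not_rapid (fun i => (φ i).comp (S.proj hM))
    (fun i => (r i).1 M) (fun i => by
      change φ i (S.proj hM ((r i).1 M)) = 1
      rw [(r i).2 N M hM, hφ, hfr])
    (fun p' hp' => hr (p'.comp ((LinearMap.proj M).comp S.limit.subtype))
      (hp'.comp ((continuous_apply M).comp continuous_subtype_val)))
  obtain ⟨m, A, hlow⟩ := hlow
  obtain ⟨q', hq', hqf'⟩ := hf (2 * A)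
  obtain ⟨K, hK, p', hp', hqp'⟩ := S.exists_step_seminorm_ge q' hq' N
  obtain ⟨n, hD⟩ := hD K hK
  obtain ⟨θ₀, ⟨hθ0, hθ1⟩, hD⟩ := hD m
  obtain ⟨k, C, hC, hD⟩ := hD (min θ₀ (1 / 2)) ⟨by positivity, min_le_left _ _⟩
  set θ := min θ₀ (1 / 2) with hθ
  have hθpos : 0 < θ := by positivity
  have hθhalf : θ ≤ 1 / 2 := min_le_right _ _
  obtain ⟨C₁, hC₁, hC₁p⟩ := LSSpace.exists_seminorm_emb_le hp n
  obtain ⟨C₂, hC₂, hC₂p⟩ := LSSpace.exists_seminorm_emb_le hp' k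
  have hn : ∀ i, (S.step N).dualNorm n (φ i) ≤ C₁ := fun i =>
    LSSpace.dualNorm_le hC₁ fun x => (hφp i _).trans (hC₁p x)
  -- the bound by `p'` holds on the image of the limit, which is dense in the step `K`
  have hdense : ∀ (i : ℕ) (y : (S.step K).E),
      ((i : ℝ) + 1) ^ (2 * A) * ‖φ i (S.proj hK y)‖ ≤ p' y := by
    intro i y
    refine (hS K).induction_on (p := fun y : (S.step K).E =>
      ((i : ℝ) + 1) ^ (2 * A) * ‖φ i (S.proj hK y)‖ ≤ p' y) y ?_ ?_
    · exact isClosed_le (continuous_const.mul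
        ((φ i).continuous.comp (S.proj hK).continuous).norm) hp'
    · intro x
      rw [x.2 N K hK, hφ]
      exact (hqf' i x).trans (hqp' x)
  have hk : ∀ i : ℕ, (S.step K).dualNorm k ((φ i).comp (S.proj hK)) ≤
      C₂ / ((i : ℝ) + 1) ^ (2 * A) := by
    intro i
    refine LSSpace.dualNorm_le (by positivity) fun x => ?_
    rw [div_mul_eq_mul_div, le_div_iff₀ (pow_pos (hi0 i) _), mul_comm]
    exact (hdense i _).trans (hC₂p x)
  obtain ⟨i, hi⟩ := hlow (C * C₂ ^ (1 - θ) * C₁ ^ θ)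
  refine absurd hi (not_lt.2 ?_)
  have h1 := hD (φ i)
  have hexp : ((((i : ℝ) + 1) ^ (2 * A)) ^ (1 - θ))⁻¹ ≤ (((i : ℝ) + 1) ^ A)⁻¹ := by
    refine inv_anti₀ (pow_pos (hi0 i) _) ?_
    rw [← Real.rpow_natCast, ← Real.rpow_natCast, ← Real.rpow_mul (hi0 i).le]
    refine Real.rpow_le_rpow_of_exponent_le (hi1 i) ?_
    push_cast
    nlinarith [(Nat.cast_nonneg A : (0 : ℝ) ≤ A)]
  have h2 : (S.step K).dualNorm k ((φ i).comp (S.proj hK)) ^ (1 - θ) ≤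
      C₂ ^ (1 - θ) * (((i : ℝ) + 1) ^ A)⁻¹ := by
    refine (Real.rpow_le_rpow (LSSpace.dualNorm_nonneg _ _) (hk i) (by linarith)).trans ?_
    rw [Real.div_rpow hC₂ (pow_pos (hi0 i) _).le, div_eq_mul_inv]
    exact mul_le_mul_of_nonneg_left hexp (by positivity)
  have h3 : (S.step N).dualNorm n (φ i) ^ θ ≤ C₁ ^ θ :=
    Real.rpow_le_rpow (LSSpace.dualNorm_nonneg _ _) (hn i) hθpos.le
  calc ((i : ℝ) + 1) ^ A * (S.step M).dualNorm m ((φ i).comp (S.proj hM))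
      ≤ ((i : ℝ) + 1) ^ A * (C * (C₂ ^ (1 - θ) * (((i : ℝ) + 1) ^ A)⁻¹) * C₁ ^ θ) := by
        refine mul_le_mul_of_nonneg_left (h1.trans ?_) (pow_pos (hi0 i) _).le
        have : 0 ≤ (S.step N).dualNorm n (φ i) ^ θ :=
          Real.rpow_nonneg (LSSpace.dualNorm_nonneg _ _) _
        gcongr
    _ = C * C₂ ^ (1 - θ) * C₁ ^ θ := by
        have := (pow_pos (hi0 i) A).ne'
        field_simp

end PLSSpectrum

/-! ### Weighted `ℓ¹`-spaces and their inductive limits -/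

section LpOne

variable {ι : Type}

lemma lp_one_hasSum_norm (x : lp (fun _ : ι => ℂ) 1) : HasSum (fun i => ‖x i‖) ‖x‖ := by
  have h := lp.hasSum_norm (p := 1) (by simp) x
  simpa using h

lemma memℓp_one_iff {f : ι → ℂ} : Memℓp f 1 ↔ Summable fun i => ‖f i‖ := by
  rw [memℓp_gen_iff (by simp)]
  simp

lemma lp_one_norm_le {x y : lp (fun _ : ι => ℂ) 1} {C : ℝ} (h : ∀ i, ‖y i‖ ≤ C * ‖x i‖) :
    ‖y‖ ≤ C * ‖x‖ :=
  hasSum_le h (lp_one_hasSum_norm y) ((lp_one_hasSum_norm x).mul_left C)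

/-- The diagonal operator on `ℓ¹` with the entries `c i` of modulus at most one. -/
def lpOneDiag (c : ι → ℂ) (hc : ∀ i, ‖c i‖ ≤ 1) :
    lp (fun _ : ι => ℂ) 1 →L[ℂ] lp (fun _ : ι => ℂ) 1 :=
  LinearMap.mkContinuous
    { toFun := fun x => ⟨fun i => c i * x i, memℓp_one_iff.2 (by
        refine Summable.of_nonneg_of_le (fun _ => norm_nonneg _) (fun i => ?_)
          (lp_one_hasSum_norm x).summable
        rw [norm_mul]
        exact mul_le_of_le_one_left (norm_nonneg _) (hc i))⟩
      map_add' := fun x y => by ext i; exact mul_add _ _ _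
      map_smul' := fun a x => by ext i; exact mul_left_comm _ _ _ }
    1 (fun x => lp_one_norm_le fun i => by
      change ‖c i * x i‖ ≤ _
      rw [norm_mul]
      exact mul_le_mul_of_nonneg_right (hc i) (norm_nonneg _))

lemma lpOneDiag_apply (c : ι → ℂ) (hc : ∀ i, ‖c i‖ ≤ 1) (x : lp (fun _ : ι => ℂ) 1) (i : ι) :
    lpOneDiag c hc x i = c i * x i := rfl

/-- A diagonal operator whose entries tend to zero is a limit of operators of finite rank. -/
lemma isCompactOperator_lpOneDiag {c : ι → ℂ} {hc : ∀ i, ‖c i‖ ≤ 1}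
    (h : Tendsto c cofinite (𝓝 0)) : IsCompactOperator (lpOneDiag c hc) := by
  classical
  let ev : ι → (lp (fun _ : ι => ℂ) 1 →L[ℂ] ℂ) := fun i =>
    LinearMap.mkContinuous
      { toFun := fun x => x i, map_add' := fun _ _ => rfl, map_smul' := fun _ _ => rfl }
      1 (fun x => (lp.norm_apply_le_norm (p := 1) (by simp) x i).trans_eq (one_mul _).symm)
  let T : Finset ι → (lp (fun _ : ι => ℂ) 1 →L[ℂ] lp (fun _ : ι => ℂ) 1) := fun F =>
    ∑ i ∈ F, c i • (lp.singleContinuousLinearMap ℂ (fun _ : ι => ℂ) 1 i).comp (ev i)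
  have hT : ∀ F x i, T F x i = if i ∈ F then c i * x i else 0 := by
    intro F x i
    have h1 : T F x = ∑ j ∈ F, c j • lp.single 1 j (x j) := by
      simp only [T, _root_.sum_apply]
      rfl
    rw [h1, lp.coeFn_sum, Finset.sum_apply]
    have h2 : ∀ j, (c j • lp.single 1 j (x j) : lp (fun _ : ι => ℂ) 1) i =
        if j = i then c i * x i else 0 := by
      intro j
      by_cases hji : j = i
      · subst hji
        simp
      · simp [hji, Ne.symm hji]
    simp only [h2, Finset.sum_ite_eq']
  refine isCompactOperator_of_tendsto (l := atTop) (F := T) ?_ (Eventually.of_forall fun F => ?_)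
  · rw [Metric.tendsto_nhds]
    intro ε hε
    have hfin : {i | ¬ ‖c i‖ < ε / 2}.Finite := by
      have := (Metric.tendsto_nhds.1 h (ε / 2) (by positivity))
      simpa [Filter.eventually_cofinite] using this
    filter_upwards [eventually_ge_atTop hfin.toFinset] with F hF
    rw [dist_eq_norm]
    refine lt_of_le_of_lt (ContinuousLinearMap.opNorm_le_bound _ (by positivity) fun x => ?_)
      (half_lt_self hε)
    refine lp_one_norm_le fun i => ?_
    rw [_root_.sub_apply, lp.coeFn_sub, Pi.sub_apply, hT, lpOneDiag_apply]
    by_cases hi : i ∈ F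
    · simp [hi]
      positivity
    · have : ‖c i‖ < ε / 2 := by
        by_contra hcon
        exact hi (hF (hfin.mem_toFinset.2 hcon))
      simp only [hi, if_false, zero_sub, norm_neg, norm_mul]
      exact mul_le_mul_of_nonneg_right this.le (norm_nonneg _)
  · have : T F ∈ compactOperator (RingHom.id ℂ) (lp (fun _ : ι => ℂ) 1)
        (lp (fun _ : ι => ℂ) 1) :=
      Submodule.sum_mem _ fun i _ => Submodule.smul_mem _ _
        ((isCompactOperator_of_locallyCompactSpace_rng
          (lp.singleContinuousLinearMap ℂ (fun _ : ι => ℂ) 1 i)).comp_clm (ev i))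
    exact this

end LpOne

/-- A decreasing sequence of positive weights on `ι` such that each quotient of consecutive
weights tends to zero. -/
structure CoechelonWeight (ι : Type) where
  w : ℕ → ι → ℝ
  pos : ∀ n i, 0 < w n i
  anti : ∀ n i, w (n + 1) i ≤ w n i
  tendsto : ∀ n, Tendsto (fun i => w (n + 1) i / w n i) cofinite (𝓝 0)

namespace CoechelonWeight

variable {ι : Type} (v : CoechelonWeight ι)

lemma antitone {n m : ℕ} (h : n ≤ m) (i : ι) : v.w m i ≤ v.w n i :=
  antitone_nat_of_succ_le (f := fun n => v.w n i) (fun n => v.anti n i) h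

/-- The union of the weighted spaces `ℓ¹(w n)`, as a space of functions. -/
def submodule : Submodule ℂ (ι → ℂ) where
  carrier := {T | ∃ n, Summable fun i => v.w n i * ‖T i‖}
  add_mem' := by
    rintro T T' ⟨n, hn⟩ ⟨m, hm⟩
    refine ⟨max n m, Summable.of_nonneg_of_le
      (fun i => mul_nonneg (v.pos _ i).le (norm_nonneg _)) (fun i => ?_) (hn.add hm)⟩
    have h1 := v.antitone (le_max_left n m) i
    have h2 := v.antitone (le_max_right n m) i
    have h3 := norm_add_le (T i) (T' i)
    have h4 := (v.pos (max n m) i).le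
    calc v.w (max n m) i * ‖T i + T' i‖ ≤ v.w (max n m) i * (‖T i‖ + ‖T' i‖) := by gcongr
      _ ≤ v.w n i * ‖T i‖ + v.w m i * ‖T' i‖ := by rw [mul_add]; gcongr
  zero_mem' := ⟨0, by simp [summable_zero]⟩
  smul_mem' := by
    rintro c T ⟨n, hn⟩
    refine ⟨n, ?_⟩
    simpa [mul_left_comm] using hn.mul_left ‖c‖

/-- The union of the weighted spaces `ℓ¹(w n)`. It is a type of its own, so that it does not
inherit the topology of pointwise convergence. -/
def Space : Type := v.submodule

instance : AddCommGroup v.Space := v.submodule.addCommGroup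

instance : Module ℂ v.Space := v.submodule.module

variable {v} in
lemma Space.ext {T T' : v.Space} (h : ∀ i, T.1 i = T'.1 i) : T = T' := Subtype.ext (funext h)

/-- The map `x ↦ x / w n` from `ℓ¹` onto `ℓ¹(w n)`. -/
def emb (n : ℕ) : lp (fun _ : ι => ℂ) 1 →ₗ[ℂ] v.Space where
  toFun x := ⟨fun i => x i / v.w n i, n, by
    refine (lp_one_hasSum_norm x).summable.congr fun i => ?_
    have := v.pos n i
    rw [norm_div, Complex.norm_real, Real.norm_of_nonneg this.le]
    field_simp⟩
  map_add' x y := Space.ext fun i => add_div _ _ _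
  map_smul' c x := Space.ext fun i => mul_div_assoc _ _ _

lemma emb_apply (n : ℕ) (x : lp (fun _ : ι => ℂ) 1) (i : ι) :
    (v.emb n x).1 i = x i / v.w n i := rfl

lemma ofReal_ne_zero (n : ℕ) (i : ι) : ((v.w n i : ℝ) : ℂ) ≠ 0 :=
  Complex.ofReal_ne_zero.2 (v.pos n i).ne'

lemma exists_emb_of_summable {n : ℕ} (T : v.Space)
    (h : Summable fun i => v.w n i * ‖T.1 i‖) :
    ∃ x, v.emb n x = T ∧ ‖x‖ = ∑' i, v.w n i * ‖T.1 i‖ := by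
  have hx : ∀ i, ‖((v.w n i : ℝ) : ℂ) * T.1 i‖ = v.w n i * ‖T.1 i‖ := fun i => by
    rw [norm_mul, Complex.norm_real, Real.norm_of_nonneg (v.pos n i).le]
  let x : lp (fun _ : ι => ℂ) 1 :=
    ⟨fun i => ((v.w n i : ℝ) : ℂ) * T.1 i, memℓp_one_iff.2 (by simpa only [hx] using h)⟩
  refine ⟨x, ?_, ?_⟩
  · refine Space.ext fun i => ?_
    rw [emb_apply]
    exact mul_div_cancel_left₀ _ (v.ofReal_ne_zero n i)
  · rw [← (lp_one_hasSum_norm x).tsum_eq]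
    exact tsum_congr hx

/-- The LS-space `ind_n ℓ¹(w n)`, a co-echelon space of order one. The Banach steps are copies
of `ℓ¹` that are embedded by `x ↦ x / w n`. -/
abbrev lsSpace : LSSpace where
  B _ := lp (fun _ : ι => ℂ) 1
  E := v.Space
  link n := lpOneDiag (fun i => ((v.w (n + 1) i / v.w n i : ℝ) : ℂ)) fun i => by
    rw [Complex.norm_real, Real.norm_of_nonneg (div_nonneg (v.pos _ i).le (v.pos _ i).le)]
    exact div_le_one_of_le₀ (v.anti n i) (v.pos n i).le
  link_compact n := isCompactOperator_lpOneDiag (by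
    have := (Complex.continuous_ofReal.tendsto 0).comp (v.tendsto n)
    rwa [Complex.ofReal_zero] at this)
  emb := v.emb
  emb_injective n x y h := by
    ext i
    have h1 := congrArg (fun T : v.Space => T.1 i) h
    simp only [emb_apply] at h1
    exact (div_left_inj' (v.ofReal_ne_zero n i)).1 h1
  emb_link n x := by
    refine Space.ext fun i => ?_
    rw [emb_apply, emb_apply, lpOneDiag_apply]
    have h1 := v.ofReal_ne_zero n i
    have h2 := v.ofReal_ne_zero (n + 1) i
    push_cast
    field_simp
  exists_emb T := by
    obtain ⟨n, hn⟩ := T.2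
    obtain ⟨x, hx, -⟩ := v.exists_emb_of_summable T hn
    exact ⟨n, x, hx⟩

instance : TopologicalSpace v.Space := indTopology v.lsSpace.emb

instance : PolynormableSpace ℂ v.Space := v.lsSpace.instPolynormableSpace

instance : IsTopologicalAddGroup v.Space := v.lsSpace.instIsTopologicalAddGroup

variable {v}

lemma hasSum_norm_emb {n : ℕ} (x : v.lsSpace.B n) :
    HasSum (fun i => v.w n i * ‖(v.emb n x).1 i‖) ‖x‖ := by
  have h : (fun i => v.w n i * ‖(v.emb n x).1 i‖) = fun i => ‖x i‖ := by
    funext i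
    have := v.pos n i
    rw [emb_apply, norm_div, Complex.norm_real, Real.norm_of_nonneg this.le]
    field_simp
  rw [h]
  exact lp_one_hasSum_norm x

/-- A weight dominated by all `w n` gives a continuous seminorm. -/
lemma exists_seminorm_coord_le [Nonempty ι] (γ : ι → ℝ) (hγ : ∀ i, 0 ≤ γ i)
    (h : ∀ n, ∃ C, ∀ i, γ i ≤ C * v.w n i) :
    ∃ p : Seminorm ℂ v.Space, Continuous p ∧ ∀ i (T : v.Space), γ i * ‖T.1 i‖ ≤ p T := by
  let g : ι → v.Space →ₗ[ℂ] ℂ := fun i => (γ i : ℂ) •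
    { toFun := fun T => T.1 i, map_add' := fun _ _ => rfl, map_smul' := fun _ _ => rfl }
  have hg : ∀ i T, ‖g i T‖ = γ i * ‖T.1 i‖ := fun i T => by
    refine (norm_mul _ _).trans ?_
    rw [Complex.norm_real, Real.norm_of_nonneg (hγ i)]
    rfl
  have hb : ∀ n, ∃ C : ℝ, ∀ x : v.lsSpace.B n, ∀ i, ‖g i (v.emb n x)‖ ≤ C * ‖x‖ := by
    intro n
    obtain ⟨C, hC⟩ := h n
    refine ⟨C, fun x i => ?_⟩
    have hC0 : 0 ≤ C := nonneg_of_mul_nonneg_left ((hγ i).trans (hC i)) (v.pos n i)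
    rw [hg]
    refine (mul_le_mul_of_nonneg_right (hC i) (norm_nonneg _)).trans ?_
    rw [mul_assoc]
    refine mul_le_mul_of_nonneg_left ?_ hC0
    exact le_hasSum (hasSum_norm_emb x) i fun p _ => mul_nonneg (v.pos n p).le (norm_nonneg _)
  have hfin : ∀ T, ∃ c, ∀ i, ‖g i T‖ ≤ c := by
    intro T
    obtain ⟨n, x, rfl⟩ := v.lsSpace.exists_emb T
    obtain ⟨C, hC⟩ := hb n
    exact ⟨_, hC x⟩
  refine ⟨iSupNorm g, LSSpace.continuous_seminorm_of_le (X := v.lsSpace) fun n => ?_,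
    fun i T => (hg i T).symm.trans_le (norm_le_iSupNorm hfin i T)⟩
  obtain ⟨C, hC⟩ := hb n
  exact ⟨C, fun x => (iSupNorm_le_iff hfin).2 (hC x)⟩

variable [DecidableEq ι]

variable (v) in
/-- The unit vector with index `i`. -/
def unit (i : ι) : v.Space :=
  ⟨Pi.single i 1, 0, summable_of_ne_finset_zero (s := {i}) fun j hj => by
    rw [Finset.notMem_singleton] at hj
    simp [hj]⟩

lemma emb_single (n : ℕ) (i : ι) (c : ℂ) :
    v.emb n (lp.single 1 i c) = (c / v.w n i) • v.unit i := by
  refine Space.ext fun j => ?_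
  rw [emb_apply]
  change _ = c / v.w n i * (Pi.single i 1 : ι → ℂ) j
  by_cases h : j = i
  · subst h
    simp
  · simp [h]

/-- A continuous seminorm is estimated by its values on the unit vectors. -/
lemma seminorm_le_tsum {p : Seminorm ℂ v.lsSpace.E} (hp : Continuous p) {g : ι → ℝ}
    (hg : ∀ i, p (v.unit i) ≤ g i) (T : v.Space) (hs : Summable fun i => ‖T.1 i‖ * g i) :
    p T ≤ ∑' i, ‖T.1 i‖ * g i := by
  obtain ⟨n, hn⟩ := T.2
  obtain ⟨x, hx, -⟩ := v.exists_emb_of_summable T hn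
  have hlim := (lp.hasSum_single (p := 1) (by simp) x)
  have hc : Continuous fun y => p (v.emb n y) := hp.comp (v.lsSpace.continuous_emb n)
  have h1 := (hc.tendsto x).comp hlim
  rw [hx] at h1
  refine le_of_tendsto h1 (Eventually.of_forall fun F => ?_)
  have hT : ∀ i, T.1 i = x i / v.w n i := fun i => by rw [← hx, emb_apply]
  have hgi : ∀ i, 0 ≤ g i := fun i => (apply_nonneg p _).trans (hg i)
  calc p (v.emb n (∑ i ∈ F, lp.single 1 i (x i)))
      = p (∑ i ∈ F, v.emb n (lp.single 1 i (x i))) := by rw [map_sum]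
    _ ≤ ∑ i ∈ F, p (v.emb n (lp.single 1 i (x i))) := by
        exact Finset.le_sum_of_subadditive p (map_zero p).le (map_add_le_add p) F _
    _ ≤ ∑ i ∈ F, ‖T.1 i‖ * g i := by
        refine Finset.sum_le_sum fun i _ => ?_
        rw [emb_single, map_smul_eq_mul, ← hT]
        exact mul_le_mul_of_nonneg_left (hg i) (norm_nonneg _)
    _ ≤ ∑' i, ‖T.1 i‖ * g i :=
        hs.sum_le_tsum F fun i _ => mul_nonneg (norm_nonneg _) (hgi i)

section Dual

variable {ι : Type} [DecidableEq ι] {v : CoechelonWeight ι}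

lemma seminorm_unit_le {p : Seminorm ℂ v.Space} {n : ℕ} {C : ℝ}
    (h : ∀ x : v.lsSpace.B n, p (v.emb n x) ≤ C * ‖x‖) (i : ι) : p (v.unit i) ≤ C * v.w n i := by
  have h1 := h (lp.single 1 i (v.w n i : ℂ))
  rw [emb_single, div_self (v.ofReal_ne_zero n i), one_smul] at h1
  refine h1.trans_eq ?_
  rw [lp.norm_single (by simp), Complex.norm_real, Real.norm_of_nonneg (v.pos n i).le]

lemma norm_unit_le_dualNorm (n : ℕ) (φ : v.lsSpace.E →L[ℂ] ℂ) (i : ι) :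
    ‖φ (v.unit i)‖ ≤ v.lsSpace.dualNorm n φ * v.w n i :=
  seminorm_unit_le (p := (normSeminorm ℂ ℂ).comp φ.toLinearMap)
    (LSSpace.norm_emb_le_dualNorm n φ) i

lemma dualNorm_le_of_unit {m : ℕ} {φ : v.lsSpace.E →L[ℂ] ℂ} {C : ℝ} (hC : 0 ≤ C)
    (h : ∀ i, ‖φ (v.unit i)‖ ≤ C * v.w m i) : v.lsSpace.dualNorm m φ ≤ C := by
  refine LSSpace.dualNorm_le hC fun x => ?_
  have hs : HasSum (fun i => ‖(v.emb m x).1 i‖ * (C * v.w m i)) (C * ‖x‖) := by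
    have h1 := (hasSum_norm_emb x).mul_left C
    have h2 : (fun i => ‖(v.emb m x).1 i‖ * (C * v.w m i)) =
        fun i => C * (v.w m i * ‖(v.emb m x).1 i‖) := by
      funext i
      ring
    rwa [h2]
  rw [← hs.tsum_eq]
  exact seminorm_le_tsum (p := (normSeminorm ℂ ℂ).comp φ.toLinearMap) φ.continuous.norm h _
    hs.summable

end Dual

/-! ### The spectrum of an increasing sequence of co-echelon spaces -/

variable {ι : Type} (v : ℕ → CoechelonWeight ι)
  (hv : ∀ {N M : ℕ}, N ≤ M → ∀ n i, (v N).w n i ≤ (v M).w n i)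

variable {v} in
lemma summable_of_le
    (hv : ∀ {N M : ℕ}, N ≤ M → ∀ n i, (v N).w n i ≤ (v M).w n i) {N M : ℕ} (h : N ≤ M)
    {n : ℕ} {a : ι → ℂ}
    (ha : Summable fun i => (v M).w n i * ‖a i‖) : Summable fun i => (v N).w n i * ‖a i‖ :=
  ha.of_nonneg_of_le (fun i => mul_nonneg ((v N).pos n i).le (norm_nonneg _))
    fun i => mul_le_mul_of_nonneg_right (hv h n i) (norm_nonneg _)

/-- The inclusion between the steps. -/
def restrict {N M : ℕ} (h : N ≤ M) : (v M).Space →ₗ[ℂ] (v N).Space where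
  toFun T := ⟨T.1, T.2.imp fun _ hn => summable_of_le hv h hn⟩
  map_add' _ _ := rfl
  map_smul' _ _ := rfl

lemma continuous_restrict {N M : ℕ} (h : N ≤ M) : Continuous (restrict v hv h) := by
  refine (PolynormableSpace.withSeminorms ℂ (v N).lsSpace.E).continuous_of_continuous_comp
    (E := (v M).lsSpace.E) (restrict v hv h) fun p => ?_
  refine LSSpace.continuous_seminorm_of_le (X := (v M).lsSpace) fun n => ?_
  obtain ⟨C, hC, hp⟩ := LSSpace.exists_seminorm_emb_le p.2 n
  refine ⟨C, fun x => ?_⟩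
  have hs := hasSum_norm_emb x
  have hs' := summable_of_le hv h hs.summable
  obtain ⟨y, hy, hyn⟩ := (v N).exists_emb_of_summable (restrict v hv h ((v M).emb n x)) hs'
  change p.1 (restrict v hv h ((v M).emb n x)) ≤ _
  rw [← hy]
  refine (hp y).trans (mul_le_mul_of_nonneg_left ?_ hC)
  rw [hyn, ← hs.tsum_eq]
  exact hs'.tsum_le_tsum (fun i => mul_le_mul_of_nonneg_right (hv h n i) (norm_nonneg _))
    hs.summable

/-- The spectrum of the co-echelon spaces given by the weights `v N`. -/
abbrev spectrum : PLSSpectrum where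
  step N := (v N).lsSpace
  proj h := ⟨restrict v hv h, continuous_restrict v hv h⟩
  proj_refl _ _ := rfl
  proj_proj _ _ _ := rfl

/-- The element of the limit that is given by the function `a`. -/
def ofFun (a : ι → ℂ) (ha : ∀ N, ∃ n, Summable fun i => (v N).w n i * ‖a i‖) :
    (spectrum v hv).limit :=
  ⟨fun N => ⟨a, ha N⟩, fun _ _ _ => rfl⟩

lemma limit_apply (x : (spectrum v hv).limit) (N : ℕ) (i : ι) : (x.1 N).1 i = (x.1 0).1 i :=
  (congrArg (fun T : (v 0).Space => T.1 i) (x.2 0 N N.zero_le))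

variable [DecidableEq ι]

/-- The unit vector with index `i` as an element of the limit. -/
def limitUnit (i : ι) : (spectrum v hv).limit := ⟨fun N => (v N).unit i, fun _ _ _ => rfl⟩

lemma isReduced_spectrum : (spectrum v hv).IsReduced := by
  intro N T
  obtain ⟨n, x, rfl⟩ := (v N).lsSpace.exists_emb T
  have hlim := (lp.hasSum_single (p := 1) (by simp) x)
  have h1 := (((v N).lsSpace.continuous_emb n).tendsto x).comp hlim
  refine mem_closure_of_tendsto h1 (Eventually.of_forall fun F => ?_)
  refine ⟨∑ i ∈ F, (x i / (v N).w n i) • limitUnit v hv i, ?_⟩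
  let π : (spectrum v hv).limit →ₗ[ℂ] (v N).Space :=
    (LinearMap.proj (R := ℂ) (φ := fun N => (v N).Space) N).comp (spectrum v hv).limit.subtype
  change π (∑ i ∈ F, (x i / (v N).w n i) • limitUnit v hv i) =
    (v N).emb n (∑ i ∈ F, lp.single 1 i (x i))
  rw [map_sum, map_sum]
  refine Finset.sum_congr rfl fun i _ => ?_
  rw [emb_single, map_smul]
  rfl

variable {v hv}

/-- The dual interpolation estimate for the unit vectors implies it for all functionals. -/
lemma interpolationInequality_of_weights {N M K : ℕ} (hM : N ≤ M) (hK : N ≤ K) {n m k : ℕ}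
    {θ C : ℝ} (hθ : θ ∈ Set.Ioo (0 : ℝ) 1) (hC : 0 ≤ C)
    (h : ∀ i, (v K).w k i ^ (1 - θ) * (v N).w n i ^ θ ≤ C * (v M).w m i) :
    (spectrum v hv).InterpolationInequality hM hK n m k θ C := by
  intro φ
  set a := (v K).lsSpace.dualNorm k (φ.comp ((spectrum v hv).proj hK)) with ha
  set b := (v N).lsSpace.dualNorm n φ with hb
  have ha0 : 0 ≤ a := LSSpace.dualNorm_nonneg _ _
  have hb0 : 0 ≤ b := LSSpace.dualNorm_nonneg _ _
  refine dualNorm_le_of_unit (by positivity) fun i => ?_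
  have h1 : ‖φ ((v N).unit i)‖ ≤ a * (v K).w k i :=
    norm_unit_le_dualNorm k (φ.comp ((spectrum v hv).proj hK)) i
  have h2 : ‖φ ((v N).unit i)‖ ≤ b * (v N).w n i := norm_unit_le_dualNorm n φ i
  change ‖φ ((v N).unit i)‖ ≤ _
  set t := ‖φ ((v N).unit i)‖
  have ht : 0 ≤ t := norm_nonneg _
  have hwK := (v K).pos k i
  have hwN := (v N).pos n i
  calc t = t ^ (1 - θ) * t ^ θ := by
        rw [← Real.rpow_add_of_nonneg ht (by linarith [hθ.2]) hθ.1.le]; simp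
    _ ≤ (a * (v K).w k i) ^ (1 - θ) * (b * (v N).w n i) ^ θ := by
        have h3 := Real.rpow_le_rpow ht h1 (by linarith [hθ.2] : 0 ≤ 1 - θ)
        have h4 := Real.rpow_le_rpow ht h2 hθ.1.le
        exact mul_le_mul h3 h4 (by positivity) (by positivity)
    _ = a ^ (1 - θ) * b ^ θ * ((v K).w k i ^ (1 - θ) * (v N).w n i ^ θ) := by
        rw [Real.mul_rpow ha0 hwK.le, Real.mul_rpow hb0 hwN.le]; ring
    _ ≤ a ^ (1 - θ) * b ^ θ * (C * (v M).w m i) :=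
        mul_le_mul_of_nonneg_left (h i) (by positivity)
    _ = C * a ^ (1 - θ) * b ^ θ * (v M).w m i := by ring

end CoechelonWeight

/-! ### The weights of the multiplier algebra -/

/-- The larger of the numbers `i + 1` and `j + 1`, for the index `p = (i, j)` of a matrix entry. -/
def maxIdx (p : ℕ × ℕ) : ℝ := (max p.1 p.2 : ℕ) + 1

/-- The smaller of the numbers `i + 1` and `j + 1`. -/
def minIdx (p : ℕ × ℕ) : ℝ := (min p.1 p.2 : ℕ) + 1

lemma one_le_maxIdx (p : ℕ × ℕ) : 1 ≤ maxIdx p := by simp [maxIdx]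

lemma one_le_minIdx (p : ℕ × ℕ) : 1 ≤ minIdx p := by simp [minIdx]

lemma maxIdx_pos (p : ℕ × ℕ) : 0 < maxIdx p := one_pos.trans_le (one_le_maxIdx p)

lemma minIdx_pos (p : ℕ × ℕ) : 0 < minIdx p := one_pos.trans_le (one_le_minIdx p)

lemma maxIdx_mul_minIdx (p : ℕ × ℕ) : maxIdx p * minIdx p = ((p.1 : ℝ) + 1) * ((p.2 : ℝ) + 1) := by
  rcases le_total p.1 p.2 with h | h <;> simp [maxIdx, minIdx, h, mul_comm]

lemma tendsto_maxIdx : Tendsto maxIdx cofinite atTop := by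
  rw [tendsto_atTop]
  intro b
  obtain ⟨n, hn⟩ := exists_nat_ge b
  refine Set.Finite.subset ((Set.finite_Iic n).prod (Set.finite_Iic n)) fun p hp => ?_
  have h1 : maxIdx p < b := not_le.1 hp
  have h2 : ((max p.1 p.2 : ℕ) : ℝ) < n := by
    rw [maxIdx] at h1
    linarith
  have h3 : max p.1 p.2 < n := by exact_mod_cast h2
  constructor
  · exact (le_max_left _ _).trans h3.le
  · exact (le_max_right _ _).trans h3.le

/-- The weights `max(i, j) ^ (N + 1 / (n + 1)) * min(i, j) ^ (-n)`, with `i + 1` and `j + 1` in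
place of `i` and `j`. The term `1 / (n + 1)` makes the quotients of consecutive weights tend to
zero, also when one of the indices is fixed. -/
def multiplierWeight (N : ℕ) : CoechelonWeight (ℕ × ℕ) where
  w n p := maxIdx p ^ ((N : ℝ) + 1 / ((n : ℝ) + 1)) * minIdx p ^ (-(n : ℝ))
  pos n p := mul_pos (Real.rpow_pos_of_pos (maxIdx_pos p) _) (Real.rpow_pos_of_pos (minIdx_pos p) _)
  anti n p := by
    refine mul_le_mul (Real.rpow_le_rpow_of_exponent_le (one_le_maxIdx p) ?_)
      (Real.rpow_le_rpow_of_exponent_le (one_le_minIdx p) ?_) (Real.rpow_nonneg (minIdx_pos p).le _)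
      (Real.rpow_nonneg (maxIdx_pos p).le _)
    · push_cast
      gcongr
      linarith
    · push_cast
      linarith
  tendsto n := by
    have hδ : 0 < 1 / ((n : ℝ) + 1) - 1 / ((n : ℝ) + 2) := by
      rw [sub_pos]
      exact one_div_lt_one_div_of_lt (by positivity) (by linarith)
    refine squeeze_zero (fun p => ?_) (fun p => ?_)
      ((tendsto_rpow_neg_atTop hδ).comp tendsto_maxIdx)
    · have := maxIdx_pos p
      have := minIdx_pos p
      positivity
    · have h1 := maxIdx_pos p
      have h2 := minIdx_pos p
      rw [mul_div_mul_comm, ← Real.rpow_sub h1, ← Real.rpow_sub h2]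
      refine (mul_le_mul ?_ ?_ (by positivity) (Real.rpow_nonneg h1.le _)).trans_eq (mul_one _)
      · refine Real.rpow_le_rpow_of_exponent_le (one_le_maxIdx p) (le_of_eq ?_)
        push_cast
        ring
      · refine Real.rpow_le_one_of_one_le_of_nonpos (one_le_minIdx p) ?_
        push_cast
        linarith

lemma multiplierWeight_mono {N M : ℕ} (h : N ≤ M) (n : ℕ) (p : ℕ × ℕ) :
    (multiplierWeight N).w n p ≤ (multiplierWeight M).w n p := by
  refine mul_le_mul_of_nonneg_right (Real.rpow_le_rpow_of_exponent_le (one_le_maxIdx p) ?_)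
    (Real.rpow_nonneg (minIdx_pos p).le _)
  have : (N : ℝ) ≤ M := by exact_mod_cast h
  linarith

/-- The spectrum of the multiplier algebra, as an algebra of matrices. -/
abbrev multiplierSpectrum : PLSSpectrum :=
  CoechelonWeight.spectrum multiplierWeight multiplierWeight_mono

theorem dualInterpolationBig_multiplierSpectrum : multiplierSpectrum.DualInterpolationBig := by
  intro N
  refine ⟨N + 2, by omega, fun K hK => ⟨0, fun m => ?_⟩⟩
  have hK2 : (0 : ℝ) < (K : ℝ) + 2 := by positivity
  -- `θ₀` is such that `(K + 2) (1 - θ) ≤ 1` for all `θ ≥ θ₀`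
  refine ⟨1 - 1 / ((K : ℝ) + 2), ⟨?_, ?_⟩, fun θ hθ => ?_⟩
  · rw [sub_pos, div_lt_one hK2]
    have : (0 : ℝ) ≤ K := K.cast_nonneg
    linarith
  · have : 0 < 1 / ((K : ℝ) + 2) := by positivity
    linarith
  have hθ1 : 0 < 1 - θ := by linarith [hθ.2]
  have hθ2 : (1 - θ) * ((K : ℝ) + 2) ≤ 1 := by
    have h1 : 1 - θ ≤ 1 / ((K : ℝ) + 2) := by linarith [hθ.1]
    rwa [le_div_iff₀ hK2] at h1
  have hθ0 : 0 < θ := by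
    have : (0 : ℝ) ≤ K := K.cast_nonneg
    nlinarith
  -- `k` absorbs the power `m` of the smaller index
  obtain ⟨k, hk⟩ := exists_nat_ge ((m : ℝ) / (1 - θ))
  rw [div_le_iff₀ hθ1] at hk
  refine ⟨k, 1, one_pos, CoechelonWeight.interpolationInequality_of_weights _ hK ⟨hθ0, hθ.2⟩
    zero_le_one fun p => ?_⟩
  have h1 := maxIdx_pos p
  have h2 := minIdx_pos p
  change (maxIdx p ^ ((K : ℝ) + 1 / ((k : ℝ) + 1)) * minIdx p ^ (-(k : ℝ))) ^ (1 - θ) *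
    (maxIdx p ^ ((N : ℝ) + 1 / (((0 : ℕ) : ℝ) + 1)) * minIdx p ^ (-((0 : ℕ) : ℝ))) ^ θ ≤
    1 * (maxIdx p ^ (((N + 2 : ℕ) : ℝ) + 1 / ((m : ℝ) + 1)) * minIdx p ^ (-(m : ℝ)))
  rw [Real.mul_rpow (by positivity) (by positivity), Real.mul_rpow (by positivity) (by positivity),
    ← Real.rpow_mul h1.le, ← Real.rpow_mul h1.le, ← Real.rpow_mul h2.le, ← Real.rpow_mul h2.le,
    mul_mul_mul_comm, ← Real.rpow_add h1, ← Real.rpow_add h2, one_mul]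
  refine mul_le_mul (Real.rpow_le_rpow_of_exponent_le (one_le_maxIdx p) ?_)
    (Real.rpow_le_rpow_of_exponent_le (one_le_minIdx p) ?_) (by positivity) (by positivity)
  · have hk1 : 1 / ((k : ℝ) + 1) ≤ 1 := by
      rw [div_le_one (by positivity)]
      have : (0 : ℝ) ≤ k := k.cast_nonneg
      linarith
    have hm1 : 0 < 1 / ((m : ℝ) + 1) := by positivity
    have hN : (0 : ℝ) ≤ N := N.cast_nonneg
    have h3 : 1 / ((k : ℝ) + 1) * (1 - θ) ≤ 1 * (1 - θ) :=
      mul_le_mul_of_nonneg_right hk1 hθ1.le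
    push_cast
    nlinarith [hθ.2]
  · push_cast
    linarith

lemma pow_le_multiplierWeight (N n : ℕ) (i : ℕ) :
    ((i : ℝ) + 1) ^ N ≤ (multiplierWeight N).w n (i, 0) := by
  have h1 : (1 : ℝ) ≤ (i : ℝ) + 1 := by
    have : (0 : ℝ) ≤ i := i.cast_nonneg
    linarith
  have : (multiplierWeight N).w n (i, 0) = ((i : ℝ) + 1) ^ ((N : ℝ) + 1 / ((n : ℝ) + 1)) := by
    simp [multiplierWeight, maxIdx, minIdx]
  rw [this, ← Real.rpow_natCast]
  refine Real.rpow_le_rpow_of_exponent_le h1 ?_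
  have : 0 < 1 / ((n : ℝ) + 1) := by positivity
  linarith

/-- The first column of a matrix is a rapidly decreasing sequence, and all such sequences occur.
This excludes the estimate for small `θ` for every spectrum with the same limit. -/
theorem not_dualInterpolationSmall_of_equiv {S : PLSSpectrum} (hS : S.IsReduced)
    (e : S.limit ≃L[ℂ] multiplierSpectrum.limit) : ¬ S.DualInterpolationSmall := by
  let c : ℕ → (multiplierWeight 0).Space →ₗ[ℂ] ℂ := fun i =>
    { toFun := fun T => T.1 (i, 0), map_add' := fun _ _ => rfl, map_smul' := fun _ _ => rfl }
  let π : ∀ A : ℕ, multiplierSpectrum.limit →ₗ[ℂ] (multiplierWeight A).Space := fun A =>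
    (LinearMap.proj (R := ℂ) (φ := fun A => (multiplierWeight A).Space) A).comp
      multiplierSpectrum.limit.subtype
  refine PLSSpectrum.not_dualInterpolationSmall hS
    (fun i => ((c i).comp (π 0)).comp e.toLinearMap)
    (fun i => e.symm (CoechelonWeight.limitUnit _ multiplierWeight_mono (i, 0))) ?_ ?_ ?_
  · intro A
    obtain ⟨p, hpc, hp⟩ := (multiplierWeight A).exists_seminorm_coord_le
      (fun q => if q.2 = 0 then ((q.1 : ℝ) + 1) ^ A else 0) (fun q => by positivity)
      (fun n => ⟨1, by
        rintro ⟨i, j⟩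
        by_cases hj : j = 0
        · subst hj
          simpa using pow_le_multiplierWeight A n i
        · simpa [hj] using ((multiplierWeight A).pos n (i, j)).le⟩)
    refine ⟨p.comp ((π A).comp e.toLinearMap),
      hpc.comp (((continuous_apply A).comp continuous_subtype_val).comp e.continuous), ?_⟩
    intro i x
    refine le_trans (le_of_eq ?_) (hp (i, 0) (π A (e x)))
    rw [if_pos rfl]
    congr 2
    exact (CoechelonWeight.limit_apply _ multiplierWeight_mono (e x) A (i, 0)).symm
  · intro i
    change ((e (e.symm (CoechelonWeight.limitUnit _ multiplierWeight_mono (i, 0)))).1 0).1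
      (i, 0) = 1
    rw [e.apply_symm_apply]
    exact Pi.single_eq_same (M := fun _ : ℕ × ℕ => ℂ) (i, 0) 1
  · intro q hq
    obtain ⟨N, -, p, hp, h⟩ := multiplierSpectrum.exists_step_seminorm_ge
      (q.comp e.symm.toLinearMap) (hq.comp e.symm.continuous) 0
    obtain ⟨C, -, hC⟩ := LSSpace.exists_seminorm_emb_le hp 0
    refine ⟨N + 1, C, fun i => (h _).trans ?_⟩
    refine (CoechelonWeight.seminorm_unit_le hC (i, 0)).trans_eq ?_
    have : (multiplierWeight N).w 0 (i, 0) = ((i : ℝ) + 1) ^ (N + 1) := by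
      simp only [multiplierWeight, maxIdx, minIdx]
      rw [← Real.rpow_natCast]
      simp
    rw [this]

/-! ### Rapidly decreasing sequences and their strong dual -/

lemma summable_inv_add_one_sq : Summable fun j : ℕ => (((j : ℝ) + 1) ^ 2)⁻¹ := by
  have := (summable_nat_add_iff 1).2 (Real.summable_nat_pow_inv.2 one_lt_two)
  simpa using this

/-- The value `π ^ 2 / 6` of `∑ j, (j + 1) ^ (-2)`. -/
def invSqSum : ℝ := ∑' j : ℕ, (((j : ℝ) + 1) ^ 2)⁻¹

lemma invSqSum_nonneg : 0 ≤ invSqSum := tsum_nonneg fun j => by positivity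

lemma exists_forall_le_of_eventually_le {f : ℕ → ℝ} {c : ℝ} (h : ∀ᶠ n in atTop, f n ≤ c) :
    ∃ C, ∀ n, f n ≤ C := by
  obtain ⟨C, hC⟩ := (isBoundedUnder_of_eventually_le h).bddAbove_range
  exact ⟨C, fun n => hC ⟨n, rfl⟩⟩

namespace NCSchwartz

lemma base_pos (j : ℕ) : (0 : ℝ) < (j : ℝ) + 1 := by positivity

lemma one_le_base (j : ℕ) : (1 : ℝ) ≤ (j : ℝ) + 1 := by simp

lemma one_le_base_pow (j n : ℕ) : (1 : ℝ) ≤ ((j : ℝ) + 1) ^ n := one_le_pow₀ (one_le_base j)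

lemma base_pow_le {n m : ℕ} (h : n ≤ m) (j : ℕ) : ((j : ℝ) + 1) ^ n ≤ ((j : ℝ) + 1) ^ m :=
  pow_le_pow_right₀ (one_le_base j) h

namespace RapidSeq

lemma ext {ξ η : RapidSeq} (h : ∀ j, ξ.coord j = η.coord j) : ξ = η := Subtype.ext (funext h)

lemma toL2_apply (n : ℕ) (ξ : RapidSeq) (j : ℕ) :
    toL2 n ξ j = ((j : ℂ) + 1) ^ n * ξ.coord j := rfl

lemma norm_toL2_apply (n : ℕ) (ξ : RapidSeq) (j : ℕ) :
    ‖toL2 n ξ j‖ = ((j : ℝ) + 1) ^ n * ‖ξ.coord j‖ := by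
  rw [toL2_apply, norm_mul, norm_natCast_add_one_pow]

lemma weight_mul_norm_coord_le (n : ℕ) (ξ : RapidSeq) (j : ℕ) :
    ((j : ℝ) + 1) ^ n * ‖ξ.coord j‖ ≤ ‖toL2 n ξ‖ :=
  (norm_toL2_apply n ξ j).symm.trans_le (lp.norm_apply_le_norm (by simp) _ _)

/-- The `j`-th entry as a linear functional. -/
def coordₗ (j : ℕ) : RapidSeq →ₗ[ℂ] ℂ where
  toFun ξ := ξ.coord j
  map_add' _ _ := rfl
  map_smul' _ _ := rfl

lemma norm_smul_coordₗ (n j : ℕ) (ξ : RapidSeq) :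
    ‖(((j : ℂ) + 1) ^ n • coordₗ j) ξ‖ = ((j : ℝ) + 1) ^ n * ‖ξ.coord j‖ :=
  (norm_mul _ _).trans (by rw [norm_natCast_add_one_pow]; rfl)

/-- The norm `sup_j (j + 1) ^ n * |ξ j|`. These norms give the topology of `s` as well. -/
def supNorm (n : ℕ) : Seminorm ℂ RapidSeq := iSupNorm fun j : ℕ => ((j : ℂ) + 1) ^ n • coordₗ j

lemma supNorm_le_iff {n : ℕ} {ξ : RapidSeq} {c : ℝ} :
    supNorm n ξ ≤ c ↔ ∀ j : ℕ, ((j : ℝ) + 1) ^ n * ‖ξ.coord j‖ ≤ c := by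
  rw [supNorm, iSupNorm_le_iff fun ξ => ⟨‖toL2 n ξ‖, fun j => ?_⟩]
  · simp only [norm_smul_coordₗ]
  · rw [norm_smul_coordₗ]
    exact weight_mul_norm_coord_le n ξ j

lemma weight_mul_norm_le_supNorm (n : ℕ) (ξ : RapidSeq) (j : ℕ) :
    ((j : ℝ) + 1) ^ n * ‖ξ.coord j‖ ≤ supNorm n ξ := supNorm_le_iff.1 le_rfl j

lemma supNorm_le_norm_toL2 (n : ℕ) (ξ : RapidSeq) : supNorm n ξ ≤ ‖toL2 n ξ‖ :=
  supNorm_le_iff.2 (weight_mul_norm_coord_le n ξ)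

lemma supNorm_mono {n m : ℕ} (h : n ≤ m) (ξ : RapidSeq) : supNorm n ξ ≤ supNorm m ξ :=
  supNorm_le_iff.2 fun j => (mul_le_mul_of_nonneg_right (base_pow_le h j) (norm_nonneg _)).trans
    (weight_mul_norm_le_supNorm m ξ j)

lemma norm_toL2_le (n : ℕ) (ξ : RapidSeq) :
    ‖toL2 n ξ‖ ≤ (1 + invSqSum) * supNorm (n + 1) ξ := by
  set Z := invSqSum with hZdef
  have hZ : 0 ≤ Z := invSqSum_nonneg
  set c := supNorm (n + 1) ξ
  have hc : 0 ≤ c := apply_nonneg _ _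
  refine lp.norm_le_of_tsum_le (by simp) (by positivity) ?_
  have hterm : ∀ j : ℕ, ‖toL2 n ξ j‖ ^ (2 : ℝ≥0∞).toReal ≤ c ^ 2 * (((j : ℝ) + 1) ^ 2)⁻¹ := by
    intro j
    have h1 := weight_mul_norm_le_supNorm (n + 1) ξ j
    have h2 := base_pos j
    have h3 : ‖toL2 n ξ j‖ ≤ c * ((j : ℝ) + 1)⁻¹ := by
      rw [norm_toL2_apply, ← div_eq_mul_inv, le_div_iff₀ h2]
      refine le_trans (le_of_eq ?_) h1
      ring
    have h4 : ‖toL2 n ξ j‖ ^ 2 ≤ (c * ((j : ℝ) + 1)⁻¹) ^ 2 := by gcongr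
    simpa [mul_pow] using h4
  have hs := summable_inv_add_one_sq.mul_left (c ^ 2)
  calc ∑' j, ‖toL2 n ξ j‖ ^ (2 : ℝ≥0∞).toReal
      ≤ ∑' j : ℕ, c ^ 2 * (((j : ℝ) + 1) ^ 2)⁻¹ :=
        (hs.of_nonneg_of_le (fun j => by positivity) hterm).tsum_le_tsum hterm hs
    _ = c ^ 2 * Z := by rw [tsum_mul_left, hZdef, invSqSum]
    _ ≤ ((1 + Z) * c) ^ 2 := by
        nlinarith [mul_nonneg (sq_nonneg c) hZ, mul_nonneg (sq_nonneg c) (sq_nonneg Z)]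
    _ = ((1 + Z) * c) ^ (2 : ℝ≥0∞).toReal := by simp

lemma withSeminorms_supNorm : WithSeminorms supNorm := by
  have h := isInducing_toProd.withSeminorms
    (withSeminorms_pi fun _ : ℕ => norm_withSeminorms ℂ (lp (fun _ : ℕ => ℂ) 2))
  refine h.congr ?_ ?_
  · intro n
    refine ⟨{⟨n, 0⟩}, 1, fun ξ => ?_⟩
    rw [Finset.sup_singleton, one_smul]
    exact supNorm_le_norm_toL2 n ξ
  · rintro ⟨n, k⟩
    refine ⟨{n + 1}, (1 + invSqSum).toNNReal, fun ξ => ?_⟩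
    rw [Finset.sup_singleton]
    refine (norm_toL2_le n ξ).trans ?_
    exact mul_le_mul_of_nonneg_right (Real.le_coe_toNNReal _) (apply_nonneg _ _)

/-- A rapidly decreasing sequence, from its entries. -/
def mk (a : ℕ → ℂ) (h : ∀ n : ℕ, ∃ C, ∀ j : ℕ, ((j : ℝ) + 1) ^ n * ‖a j‖ ≤ C) : RapidSeq :=
  ⟨a, fun n => by
    obtain ⟨C, hC⟩ := h (n + 1)
    refine (memℓp_gen_iff (by simp)).2 ?_
    refine Summable.of_nonneg_of_le (fun j => by positivity) (fun j => ?_)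
      (summable_inv_add_one_sq.mul_left (C ^ 2))
    have h2 := base_pos j
    have h3 : ‖weighted n a j‖ ≤ C * ((j : ℝ) + 1)⁻¹ := by
      rw [weighted, norm_mul, norm_natCast_add_one_pow, ← div_eq_mul_inv, le_div_iff₀ h2]
      refine le_trans (le_of_eq ?_) (hC j)
      ring
    have h4 : ‖weighted n a j‖ ^ 2 ≤ (C * ((j : ℝ) + 1)⁻¹) ^ 2 := by gcongr
    simpa [mul_pow] using h4⟩

lemma coord_mk (a : ℕ → ℂ) (h) (j : ℕ) : (mk a h).coord j = a j := rfl

lemma continuous_supNorm (n : ℕ) : Continuous (supNorm n) :=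
  withSeminorms_supNorm.continuous_seminorm n

lemma isVonNBounded_iff {D : Set RapidSeq} :
    Bornology.IsVonNBounded ℂ D ↔
      ∀ n : ℕ, ∃ C, ∀ ξ ∈ D, ∀ j : ℕ, ((j : ℝ) + 1) ^ n * ‖ξ.coord j‖ ≤ C := by
  rw [withSeminorms_supNorm.isVonNBounded_iff_seminorm_bounded]
  refine forall_congr' fun n => ⟨?_, ?_⟩
  · rintro ⟨C, -, h⟩
    exact ⟨C, fun ξ hξ => supNorm_le_iff.1 (h ξ hξ).le⟩
  · rintro ⟨C, h⟩
    refine ⟨max C 0 + 1, by positivity, fun ξ hξ => ?_⟩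
    have := supNorm_le_iff.2 (h ξ hξ)
    have := le_max_left C 0
    linarith

lemma exists_le_supNorm (q : Seminorm ℂ RapidSeq) (hq : Continuous q) :
    ∃ (n : ℕ) (C : ℝ), 0 ≤ C ∧ ∀ ξ, q ξ ≤ C * supNorm n ξ := by
  obtain ⟨t, C, -, h⟩ := Seminorm.bound_of_continuous withSeminorms_supNorm q hq
  refine ⟨t.sup id, C, C.2, fun ξ => (h ξ).trans (mul_le_mul_of_nonneg_left ?_ C.2)⟩
  exact Seminorm.finset_sup_apply_le (apply_nonneg _ _) fun n hn =>
    supNorm_mono (Finset.le_sup (f := id) hn) ξ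

/-- The unit vectors. -/
def e (j : ℕ) : RapidSeq := mk (Pi.single j 1) fun n => ⟨((j : ℝ) + 1) ^ n, fun k => by
  by_cases h : k = j
  · subst h
    simp
  · simp [h]
    positivity⟩

lemma coord_e (j k : ℕ) : (e j).coord k = if k = j then 1 else 0 := by
  simp [e, coord_mk, Pi.single_apply]

lemma coord_sum_smul_e (F : Finset ℕ) (a : ℕ → ℂ) (k : ℕ) :
    (∑ j ∈ F, a j • e j).coord k = if k ∈ F then a k else 0 := by
  have h : (∑ j ∈ F, a j • e j).coord k = ∑ j ∈ F, a j * (e j).coord k := by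
    change coordₗ k _ = _
    rw [map_sum]
    rfl
  rw [h]
  simp [coord_e]

/-- The error of a partial sum `∑ j ∈ F, ξ j e_j` with `F ⊇ {0, …, J - 1}`. -/
lemma supNorm_sub_sum_le {n J : ℕ} {C : ℝ} {ξ : RapidSeq} (hC : 0 ≤ C)
    (h : ∀ j : ℕ, ((j : ℝ) + 1) ^ (n + 1) * ‖ξ.coord j‖ ≤ C) {F : Finset ℕ}
    (hF : Finset.range J ⊆ F) :
    supNorm n (ξ - ∑ j ∈ F, ξ.coord j • e j) ≤ C / ((J : ℝ) + 1) := by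
  refine supNorm_le_iff.2 fun k => ?_
  have hk : (ξ - ∑ j ∈ F, ξ.coord j • e j).coord k = if k ∈ F then 0 else ξ.coord k := by
    have : (ξ - ∑ j ∈ F, ξ.coord j • e j).coord k =
      ξ.coord k - (∑ j ∈ F, ξ.coord j • e j).coord k := rfl
    rw [this, coord_sum_smul_e]
    split_ifs <;> simp
  rw [hk]
  split_ifs with hkF
  · simp
    positivity
  · have hJ : J ≤ k := by
      by_contra hcon
      exact hkF (hF (Finset.mem_range.2 (not_le.1 hcon)))
    have h1 : (J : ℝ) + 1 ≤ (k : ℝ) + 1 := by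
      have : (J : ℝ) ≤ k := by exact_mod_cast hJ
      linarith
    rw [le_div_iff₀ (base_pos J)]
    have h2 := h k
    rw [pow_succ] at h2
    have h3 : 0 ≤ ((k : ℝ) + 1) ^ n * ‖ξ.coord k‖ := by positivity
    nlinarith

lemma hasSum_coord_smul_e (ξ : RapidSeq) : HasSum (fun j => ξ.coord j • e j) ξ := by
  rw [HasSum, withSeminorms_supNorm.tendsto_nhds]
  intro n ε hε
  obtain ⟨J, hJ⟩ := exists_nat_gt (supNorm (n + 1) ξ / ε)
  filter_upwards [eventually_ge_atTop (Finset.range J)] with F hF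
  rw [map_sub_rev]
  refine lt_of_le_of_lt (supNorm_sub_sum_le (apply_nonneg _ _)
    (weight_mul_norm_le_supNorm (n + 1) ξ) hF) ?_
  rw [div_lt_iff₀ hε] at hJ
  rw [div_lt_iff₀ (base_pos J)]
  linarith

end RapidSeq

open RapidSeq

namespace SlowSeq

/-- The `j`-th entry as an element of the dual of `s`. -/
def ε (j : ℕ) : SlowSeq := ⟨coordₗ j, withSeminorms_supNorm.continuous_normedSpace_rng ℂ _
  ⟨{0}, 1, fun ξ => by
    have h := weight_mul_norm_le_supNorm 0 ξ j
    rw [pow_zero, one_mul] at h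
    rw [Finset.sup_singleton, one_smul]
    exact h⟩⟩

lemma ε_apply (j : ℕ) (ξ : RapidSeq) : ε j ξ = ξ.coord j := rfl

lemma incl_e (j : ℕ) : incl (e j) = ε j := by
  ext η
  rw [incl_apply, ε_apply, tsum_eq_single j]
  · simp [coord_e]
  · intro k hk
    simp [coord_e, hk]

lemma exists_norm_apply_le (y : SlowSeq) :
    ∃ (n : ℕ) (C : ℝ), 0 ≤ C ∧ ∀ ξ, ‖y ξ‖ ≤ C * supNorm n ξ :=
  exists_le_supNorm ((normSeminorm ℂ ℂ).comp y.toLinearMap) y.continuous.norm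

/-- The sequence space expansion converges uniformly on bounded sets of `s`. -/
lemma hasSum_smul_ε (y : SlowSeq) : HasSum (fun j => y (e j) • ε j) y := by
  rw [HasSum, ← tendsto_sub_nhds_zero_iff]
  rw [(ContinuousLinearMap.hasBasis_nhds_zero_of_basis (E := RapidSeq) (F := ℂ)
    (σ := RingHom.id ℂ) (Metric.nhds_basis_ball)).tendsto_right_iff]
  rintro ⟨D, r⟩ ⟨hD, hr : 0 < r⟩
  obtain ⟨n, C, hC, hy⟩ := exists_norm_apply_le y
  obtain ⟨C', hC'⟩ := RapidSeq.isVonNBounded_iff.1 hD (n + 1)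
  obtain ⟨J, hJ⟩ := exists_nat_gt (C * max C' 0 / r)
  filter_upwards [eventually_ge_atTop (Finset.range J)] with F hF
  intro ξ hξ
  have h1 : (∑ j ∈ F, y (e j) • ε j - y) ξ = - y (ξ - ∑ j ∈ F, ξ.coord j • e j) := by
    rw [map_sub, map_sum, _root_.sub_apply, _root_.sum_apply]
    simp only [map_smul, smul_eq_mul, _root_.smul_apply, ε_apply, neg_sub]
    congr 1
    exact Finset.sum_congr rfl fun j _ => mul_comm _ _
  rw [h1, mem_ball_zero_iff, norm_neg]
  refine (hy _).trans_lt ?_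
  have h2 := supNorm_sub_sum_le (le_max_right C' 0)
    (fun j => (hC' ξ hξ j).trans (le_max_left C' 0)) hF
  refine (mul_le_mul_of_nonneg_left h2 hC).trans_lt ?_
  rw [div_lt_iff₀ hr] at hJ
  rw [← mul_div_assoc, div_lt_iff₀ (base_pos J)]
  linarith

/-- A bounded set of `s'` has polynomial growth uniformly. Otherwise there are elements `y q` of
the set and indices `j q` with `|y q (j q)| > q (j q + 1) ^ q`, and the set is not uniformly
bounded on the bounded sequence of the vectors `(j q + 1) ^ (-q) e_{j q}`. -/
lemma exists_growth_of_isVonNBounded {B : Set SlowSeq} (hB : Bornology.IsVonNBounded ℂ B) :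
    ∃ (n : ℕ) (C : ℝ), 0 ≤ C ∧ ∀ y ∈ B, ∀ j : ℕ, ‖y (e j)‖ ≤ C * ((j : ℝ) + 1) ^ n := by
  by_contra! hcon
  choose y hyB j hj using fun q : ℕ => hcon q q q.cast_nonneg
  have hD : Bornology.IsVonNBounded ℂ
      (Set.range fun q : ℕ => ((((j q : ℂ) + 1) ^ q)⁻¹ : ℂ) • e (j q)) := by
    rw [RapidSeq.isVonNBounded_iff]
    intro n
    have hev : ∀ᶠ q in atTop, ((j q : ℝ) + 1) ^ n * (((j q : ℝ) + 1) ^ q)⁻¹ ≤ 1 := by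
      filter_upwards [eventually_ge_atTop n] with q hq
      rw [← div_eq_mul_inv, div_le_one (pow_pos (base_pos _) _)]
      exact base_pow_le hq _
    obtain ⟨C, hC⟩ := exists_forall_le_of_eventually_le hev
    refine ⟨C, ?_⟩
    rintro _ ⟨q, rfl⟩ k
    have h1 : (((((j q : ℂ) + 1) ^ q)⁻¹ : ℂ) • e (j q)).coord k =
      (((j q : ℂ) + 1) ^ q)⁻¹ * (e (j q)).coord k := rfl
    rw [h1, coord_e]
    by_cases hk : k = j q
    · rw [if_pos hk, hk, mul_one, norm_inv, norm_natCast_add_one_pow]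
      exact hC q
    · have : 0 ≤ C := le_trans (by positivity) (hC q)
      simpa [hk] using this
  have hb := ContinuousLinearMap.isVonNBounded_image2_apply (R := ℂ) hB hD
  rw [NormedSpace.isVonNBounded_iff, isBounded_iff_forall_norm_le] at hb
  obtain ⟨C, hC⟩ := hb
  obtain ⟨q, hq⟩ := exists_nat_gt C
  have h1 := hC _ (Set.mem_image2_of_mem (hyB q) ⟨q, rfl⟩)
  rw [map_smul, norm_smul, norm_inv, norm_natCast_add_one_pow, inv_mul_le_iff₀
    (pow_pos (base_pos _) _)] at h1
  have h2 := hj q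
  have h3 := pow_pos (base_pos (j q)) q
  nlinarith

lemma isVonNBounded_range_smul_ε (q : ℕ) :
    Bornology.IsVonNBounded ℂ (Set.range fun j : ℕ => (((j : ℂ) + 1) ^ q) • ε j) := by
  rw [ContinuousLinearMap.isVonNBounded_iff]
  intro D hD
  obtain ⟨C, hC⟩ := RapidSeq.isVonNBounded_iff.1 hD q
  rw [NormedSpace.isVonNBounded_iff, isBounded_iff_forall_norm_le]
  refine ⟨C, ?_⟩
  rintro _ ⟨_, ⟨j, rfl⟩, ξ, hξ, rfl⟩
  refine le_trans (le_of_eq ?_) (hC ξ hξ j)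
  rw [← norm_natCast_add_one_pow]
  exact norm_mul _ _

end SlowSeq
open SlowSeq

/-! ### The noncommutative Schwartz space as a space of matrices -/

/-- The rapidly decreasing matrices. -/
def IsRapid (a : ℕ → ℕ → ℂ) : Prop :=
  ∀ q : ℕ, ∃ C, ∀ i j : ℕ, ((i : ℝ) + 1) ^ q * ((j : ℝ) + 1) ^ q * ‖a i j‖ ≤ C

/-- A weight with different powers of the indices is dominated by a symmetric one. -/
lemma weight_le_weight_add {p q : ℕ} (i j : ℕ) {t : ℝ} (ht : 0 ≤ t) :
    ((i : ℝ) + 1) ^ p * ((j : ℝ) + 1) ^ q * t ≤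
      ((i : ℝ) + 1) ^ (p + q) * ((j : ℝ) + 1) ^ (p + q) * t := by
  have h1 := base_pow_le (Nat.le_add_right p q) i
  have h2 := base_pow_le (Nat.le_add_left q p) j
  have := base_pos i
  have := base_pos j
  gcongr

lemma IsRapid.swap {a : ℕ → ℕ → ℂ} (ha : IsRapid a) : IsRapid fun i j => a j i := by
  intro q
  obtain ⟨C, hC⟩ := ha q
  refine ⟨C, fun i j => ?_⟩
  rw [mul_comm (((i : ℝ) + 1) ^ q)]
  exact hC j i

lemma IsRapid.exists_bound {a : ℕ → ℕ → ℂ} (ha : IsRapid a) (p q : ℕ) :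
    ∃ C, ∀ i j : ℕ, ((i : ℝ) + 1) ^ p * ((j : ℝ) + 1) ^ q * ‖a i j‖ ≤ C := by
  obtain ⟨C, hC⟩ := ha (p + q)
  exact ⟨C, fun i j => (weight_le_weight_add i j (norm_nonneg _)).trans (hC i j)⟩

namespace Smooth

/-- The entries of the matrix of an operator `s' → s`. -/
def entry (x : Smooth) (i j : ℕ) : ℂ := (x (ε j)).coord i

/-- The entry with the indices `i`, `j` as a linear functional. -/
def entryₗ (i j : ℕ) : Smooth →ₗ[ℂ] ℂ where
  toFun x := entry x i j
  map_add' _ _ := rfl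
  map_smul' _ _ := rfl

lemma hasSum_coord_apply (x : Smooth) (y : SlowSeq) (i : ℕ) :
    HasSum (fun j => y (e j) * entry x i j) ((x y).coord i) := by
  have h : (fun j => y (e j) * entry x i j) = fun j => ((ε i).comp x) (y (e j) • ε j) := by
    funext j
    rw [map_smul]
    rfl
  rw [h]
  exact ((ε i).comp x).hasSum (hasSum_smul_ε y)

lemma ext {x x' : Smooth} (h : ∀ i j, entry x i j = entry x' i j) : x = x' := by
  refine ContinuousLinearMap.ext fun y => RapidSeq.ext fun i => ?_
  have h1 := hasSum_coord_apply x y i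
  simp only [h] at h1
  exact h1.unique (hasSum_coord_apply x' y i)

lemma hasSum_entry_opMul (x y : Smooth) (i k : ℕ) :
    HasSum (fun j => entry x i j * entry y j k) (entry (opMul x y) i k) := by
  have h : (fun j => entry x i j * entry y j k) =
      fun j => ((ε i).comp (x.comp incl)) ((y (ε k)).coord j • e j) := by
    funext j
    rw [map_smul, ContinuousLinearMap.comp_apply, ContinuousLinearMap.comp_apply, incl_e]
    exact mul_comm _ _
  rw [h]
  exact ((ε i).comp (x.comp incl)).hasSum (hasSum_coord_smul_e (y (ε k)))

lemma isRapid_entry (x : Smooth) : IsRapid (entry x) := by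
  intro q
  have hb := (isVonNBounded_range_smul_ε q).image x
  obtain ⟨C, hC⟩ := RapidSeq.isVonNBounded_iff.1 hb q
  refine ⟨C, fun i j => ?_⟩
  refine le_trans (le_of_eq ?_) (hC _ ⟨_, ⟨j, rfl⟩, rfl⟩ i)
  rw [map_smul, mul_assoc, ← norm_natCast_add_one_pow j, ← norm_mul]
  rfl

/-- The supremum of `(i + 1) ^ q * (j + 1) ^ q * |x i j|`. -/
def matNorm (q : ℕ) : Seminorm ℂ Smooth :=
  iSupNorm fun p : ℕ × ℕ => (((p.1 : ℂ) + 1) ^ q * ((p.2 : ℂ) + 1) ^ q) • entryₗ p.1 p.2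

lemma matNorm_le_iff {q : ℕ} {x : Smooth} {c : ℝ} :
    matNorm q x ≤ c ↔
      ∀ i j : ℕ, ((i : ℝ) + 1) ^ q * ((j : ℝ) + 1) ^ q * ‖entry x i j‖ ≤ c := by
  have hn : ∀ (p : ℕ × ℕ) x,
      ‖((((p.1 : ℂ) + 1) ^ q * ((p.2 : ℂ) + 1) ^ q) • entryₗ p.1 p.2) x‖ =
        ((p.1 : ℝ) + 1) ^ q * ((p.2 : ℝ) + 1) ^ q * ‖entry x p.1 p.2‖ := fun p x =>
    (norm_mul _ _).trans (by
      rw [norm_mul, norm_natCast_add_one_pow, norm_natCast_add_one_pow]; rfl)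
  rw [matNorm, iSupNorm_le_iff]
  · simp only [hn, Prod.forall]
  · intro x
    obtain ⟨C, hC⟩ := isRapid_entry x q
    exact ⟨C, fun p => (hn p x).trans_le (hC p.1 p.2)⟩

lemma weight_mul_norm_entry_le (q : ℕ) (x : Smooth) (i j : ℕ) :
    ((i : ℝ) + 1) ^ q * ((j : ℝ) + 1) ^ q * ‖entry x i j‖ ≤ matNorm q x :=
  matNorm_le_iff.1 le_rfl i j

lemma weight_mul_norm_entry_le' (p q : ℕ) (x : Smooth) (i j : ℕ) :
    ((i : ℝ) + 1) ^ p * ((j : ℝ) + 1) ^ q * ‖entry x i j‖ ≤ matNorm (p + q) x :=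
  (weight_le_weight_add i j (norm_nonneg _)).trans (weight_mul_norm_entry_le _ x i j)

lemma continuous_matNorm (q : ℕ) : Continuous (matNorm q) := by
  refine Seminorm.continuous' (r := 1) ?_
  have h := ContinuousLinearMap.eventually_nhds_zero_mapsTo (σ := RingHom.id ℂ) (F := RapidSeq)
    (isVonNBounded_range_smul_ε q)
    (U := (supNorm q).ball 0 1) (Seminorm.ball_mem_nhds (continuous_supNorm q) one_pos)
  filter_upwards [h] with x hx
  rw [Seminorm.mem_closedBall_zero, matNorm_le_iff]
  intro i j
  have h1 := hx ⟨j, rfl⟩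
  rw [Seminorm.mem_ball_zero] at h1
  refine le_trans (le_of_eq ?_) (supNorm_le_iff.1 h1.le i)
  rw [map_smul, mul_assoc, ← norm_natCast_add_one_pow j, ← norm_mul]
  rfl

lemma withSeminorms_matNorm : WithSeminorms matNorm := by
  rw [SeminormFamily.withSeminorms_iff_nhds_eq_iInf]
  refine le_antisymm (le_iInf fun q => ?_) ?_
  · rw [← Filter.tendsto_iff_comap]
    simpa using (continuous_matNorm q).tendsto 0
  · intro U hU
    obtain ⟨⟨B, V⟩, ⟨hB, hV⟩, hBV⟩ :=
      (ContinuousLinearMap.hasBasis_nhds_zero (E := SlowSeq) (F := RapidSeq)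
        (σ := RingHom.id ℂ)).mem_iff.1 hU
    obtain ⟨n, C, hC, hB⟩ := exists_growth_of_isVonNBounded hB
    obtain ⟨s, r, hr, hsV⟩ := (withSeminorms_supNorm.mem_nhds_iff 0 V).1 hV
    set m := s.sup id
    set Z := invSqSum with hZdef
    have hZ : 0 ≤ Z := invSqSum_nonneg
    have hCZ : 0 < C * Z + 1 := by positivity
    refine mem_iInf_of_mem (m + (n + 2)) (mem_comap.2
      ⟨Set.Iio (r / (C * Z + 1)), Iio_mem_nhds (by positivity), fun x hx => hBV fun y hy => hsV ?_⟩)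
    have hx' : matNorm (m + (n + 2)) x < r / (C * Z + 1) := hx
    have hmain : supNorm m (x y) ≤ C * Z * matNorm (m + (n + 2)) x := by
      refine supNorm_le_iff.2 fun i => ?_
      have hs := hasSum_coord_apply x y i
      have hle : ∀ j : ℕ, ‖y (e j) * entry x i j‖ ≤
          (C * matNorm (m + (n + 2)) x / ((i : ℝ) + 1) ^ m) * (((j : ℝ) + 1) ^ 2)⁻¹ := by
        intro j
        have h1 := hB y hy j
        have h2 := weight_mul_norm_entry_le' m (n + 2) x i j
        have hi := pow_pos (base_pos i) m
        have hj := pow_pos (base_pos j) 2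
        rw [norm_mul, ← div_eq_mul_inv, le_div_iff₀ hj, le_div_iff₀ hi]
        calc ‖y (e j)‖ * ‖entry x i j‖ * ((j : ℝ) + 1) ^ 2 * ((i : ℝ) + 1) ^ m
            ≤ C * ((j : ℝ) + 1) ^ n * ‖entry x i j‖ * ((j : ℝ) + 1) ^ 2 * ((i : ℝ) + 1) ^ m := by
              gcongr
          _ = C * (((i : ℝ) + 1) ^ m * ((j : ℝ) + 1) ^ (n + 2) * ‖entry x i j‖) := by ring
          _ ≤ _ := by gcongr
      have hsZ := summable_inv_add_one_sq.mul_left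
        (C * matNorm (m + (n + 2)) x / ((i : ℝ) + 1) ^ m)
      have h3 := tsum_of_norm_bounded hsZ.hasSum hle
      rw [hs.tsum_eq, tsum_mul_left, ← invSqSum, ← hZdef, div_mul_eq_mul_div,
        le_div_iff₀ (pow_pos (base_pos i) m)] at h3
      linarith
    rw [Seminorm.mem_ball, sub_zero]
    refine Seminorm.finset_sup_apply_lt hr fun k hk => ?_
    refine (supNorm_mono (Finset.le_sup (f := id) hk) _).trans_lt (hmain.trans_lt ?_)
    rw [lt_div_iff₀ hCZ] at hx'
    have : 0 ≤ matNorm (m + (n + 2)) x := apply_nonneg _ _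
    nlinarith

lemma isVonNBounded_iff {B : Set Smooth} :
    Bornology.IsVonNBounded ℂ B ↔ ∀ q : ℕ, ∃ C, ∀ x ∈ B, ∀ i j : ℕ,
      ((i : ℝ) + 1) ^ q * ((j : ℝ) + 1) ^ q * ‖entry x i j‖ ≤ C := by
  rw [withSeminorms_matNorm.isVonNBounded_iff_seminorm_bounded]
  refine forall_congr' fun n => ⟨?_, ?_⟩
  · rintro ⟨C, -, h⟩
    exact ⟨C, fun ξ hξ => matNorm_le_iff.1 (h ξ hξ).le⟩
  · rintro ⟨C, h⟩
    refine ⟨max C 0 + 1, by positivity, fun ξ hξ => ?_⟩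
    have := matNorm_le_iff.2 (h ξ hξ)
    have := le_max_left C 0
    linarith

lemma matNorm_mono {n m : ℕ} (h : n ≤ m) (x : Smooth) : matNorm n x ≤ matNorm m x := by
  refine matNorm_le_iff.2 fun i j => le_trans ?_ (weight_mul_norm_entry_le m x i j)
  have h1 := base_pow_le h i
  have h2 := base_pow_le h j
  have := base_pos i
  have := base_pos j
  gcongr

lemma exists_matNorm_ball_subset {V : Set Smooth} (hV : V ∈ 𝓝 (0 : Smooth)) :
    ∃ (q : ℕ) (r : ℝ), 0 < r ∧ ∀ x, matNorm q x < r → x ∈ V := by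
  obtain ⟨s, r, hr, h⟩ := (withSeminorms_matNorm.mem_nhds_iff 0 V).1 hV
  refine ⟨s.sup id, r, hr, fun x hx => h ?_⟩
  rw [Seminorm.mem_ball, sub_zero]
  exact Seminorm.finset_sup_apply_lt hr fun k hk =>
    (matNorm_mono (Finset.le_sup (f := id) hk) x).trans_lt hx

/-- The rows of a rapidly decreasing matrix. -/
def row (a : ℕ → ℕ → ℂ) (ha : IsRapid a) (i : ℕ) : RapidSeq :=
  RapidSeq.mk (a i) fun n => by
    obtain ⟨C, hC⟩ := ha.exists_bound 0 n
    refine ⟨C, fun j => ?_⟩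
    simpa using hC i j

/-- The operator with a given rapidly decreasing matrix. The `i`-th entry of the image of `y` is
the value of `y` on the `i`-th row of the matrix. -/
def ofMatrix (a : ℕ → ℕ → ℂ) (ha : IsRapid a) : Smooth :=
  have hrow : ∀ p q : ℕ, ∃ C, ∀ i : ℕ, ((i : ℝ) + 1) ^ p * supNorm q (row a ha i) ≤ C := by
    intro p q
    obtain ⟨C, hC⟩ := ha.exists_bound p q
    refine ⟨C, fun i => ?_⟩
    rw [← le_div_iff₀' (pow_pos (base_pos i) p)]
    refine supNorm_le_iff.2 fun j => ?_
    rw [le_div_iff₀' (pow_pos (base_pos i) p), ← mul_assoc]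
    exact hC i j
  let f : SlowSeq →ₗ[ℂ] RapidSeq :=
    { toFun := fun y => RapidSeq.mk (fun i => y (row a ha i)) fun p => by
        obtain ⟨q, C, hC, hy⟩ := exists_norm_apply_le y
        obtain ⟨C', hC'⟩ := hrow p q
        refine ⟨C * C', fun i => ?_⟩
        calc ((i : ℝ) + 1) ^ p * ‖y (row a ha i)‖
            ≤ ((i : ℝ) + 1) ^ p * (C * supNorm q (row a ha i)) := by gcongr; exact hy _
          _ = C * (((i : ℝ) + 1) ^ p * supNorm q (row a ha i)) := by ring
          _ ≤ C * C' := mul_le_mul_of_nonneg_left (hC' i) hC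
      map_add' := fun _ _ => rfl
      map_smul' := fun _ _ => rfl }
  ⟨f, by
    refine withSeminorms_supNorm.continuous_of_continuous_comp f fun p => ?_
    refine Seminorm.continuous' (r := 1) ?_
    have hD : Bornology.IsVonNBounded ℂ
        (Set.range fun i : ℕ => (((i : ℂ) + 1) ^ p) • row a ha i) := by
      rw [RapidSeq.isVonNBounded_iff]
      intro q
      obtain ⟨C, hC⟩ := ha.exists_bound p q
      refine ⟨C, ?_⟩
      rintro _ ⟨i, rfl⟩ j
      refine le_trans (le_of_eq ?_) (hC i j)
      rw [mul_comm (((i : ℝ) + 1) ^ p), mul_assoc, ← norm_natCast_add_one_pow i, ← norm_mul]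
      rfl
    have h := ContinuousLinearMap.eventually_nhds_zero_mapsTo (σ := RingHom.id ℂ) (F := ℂ)
      hD (U := Metric.closedBall 0 1) (Metric.closedBall_mem_nhds 0 one_pos)
    filter_upwards [h] with y hy
    rw [Seminorm.mem_closedBall_zero]
    refine supNorm_le_iff.2 fun i => ?_
    have h1 := hy ⟨i, rfl⟩
    rw [mem_closedBall_zero_iff, map_smul, norm_smul, norm_natCast_add_one_pow] at h1
    exact h1⟩

lemma entry_ofMatrix (a : ℕ → ℕ → ℂ) (ha : IsRapid a) (i j : ℕ) :
    entry (ofMatrix a ha) i j = a i j := rfl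

/-- A multiple of a matrix unit. -/
def single (a b : ℕ) (c : ℂ) : Smooth :=
  ofMatrix (fun i j => if i = a ∧ j = b then c else 0) fun q => by
    refine ⟨((a : ℝ) + 1) ^ q * ((b : ℝ) + 1) ^ q * ‖c‖, fun i j => ?_⟩
    dsimp only
    by_cases h : i = a ∧ j = b
    · rw [if_pos h, h.1, h.2]
    · rw [if_neg h, norm_zero, mul_zero]
      positivity

lemma entry_single (a b : ℕ) (c : ℂ) (i j : ℕ) :
    entry (single a b c) i j = if i = a ∧ j = b then c else 0 := rfl

end Smooth
open Smooth

/-! ### Multiplication by matrices of moderate growth -/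

/-- The matrices `t` such that for each `q` the entries `t i j` are `O((i + 1) ^ (-q))` up to a
power of `j + 1`, that is, the matrices of the operators on `s`. -/
def IsColumnMultiplier (t : ℕ → ℕ → ℂ) : Prop :=
  ∀ q : ℕ, ∃ (n : ℕ) (C : ℝ), ∀ i j : ℕ, ((i : ℝ) + 1) ^ q * ‖t i j‖ ≤ C * ((j : ℝ) + 1) ^ n

lemma norm_mul_le_inv_sq {u v : ℕ → ℂ} {D E : ℝ} {n : ℕ} (hD : 0 ≤ D)
    (hu : ∀ b : ℕ, ‖u b‖ ≤ D * ((b : ℝ) + 1) ^ n)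
    (hv : ∀ b : ℕ, ((b : ℝ) + 1) ^ (n + 2) * ‖v b‖ ≤ E) (b : ℕ) :
    ‖u b * v b‖ ≤ D * E * (((b : ℝ) + 1) ^ 2)⁻¹ := by
  have hb := pow_pos (base_pos b) 2
  rw [norm_mul, ← div_eq_mul_inv, le_div_iff₀ hb]
  calc ‖u b‖ * ‖v b‖ * ((b : ℝ) + 1) ^ 2
      ≤ D * ((b : ℝ) + 1) ^ n * ‖v b‖ * ((b : ℝ) + 1) ^ 2 := by
        gcongr
        exact hu b
    _ = D * (((b : ℝ) + 1) ^ (n + 2) * ‖v b‖) := by ring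
    _ ≤ D * E := mul_le_mul_of_nonneg_left (hv b) hD

lemma norm_tsum_mul_le {u v : ℕ → ℂ} {D E : ℝ} {n : ℕ} (hD : 0 ≤ D)
    (hu : ∀ b : ℕ, ‖u b‖ ≤ D * ((b : ℝ) + 1) ^ n)
    (hv : ∀ b : ℕ, ((b : ℝ) + 1) ^ (n + 2) * ‖v b‖ ≤ E) :
    ‖∑' b, u b * v b‖ ≤ D * E * invSqSum := by
  have h := tsum_of_norm_bounded (summable_inv_add_one_sq.mul_left (D * E)).hasSum
    (norm_mul_le_inv_sq hD hu hv)
  rwa [tsum_mul_left] at h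

lemma nonneg_of_weight_bound {C : ℝ} {q n : ℕ} {t : ℕ → ℕ → ℂ}
    (h : ∀ i j : ℕ, ((i : ℝ) + 1) ^ q * ‖t i j‖ ≤ C * ((j : ℝ) + 1) ^ n) : 0 ≤ C := by
  have h1 := h 0 0
  simp only [Nat.cast_zero, zero_add, one_pow, one_mul, mul_one] at h1
  exact (norm_nonneg _).trans h1

/-- The product of a column multiplier with a matrix, with explicit constants. -/
lemma weight_mul_norm_tsum_le {t y : ℕ → ℕ → ℂ} {q n : ℕ} {C E : ℝ}
    (ht : ∀ i j : ℕ, ((i : ℝ) + 1) ^ q * ‖t i j‖ ≤ C * ((j : ℝ) + 1) ^ n)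
    (hy : ∀ j k : ℕ, ((j : ℝ) + 1) ^ (n + 2) * ((k : ℝ) + 1) ^ q * ‖y j k‖ ≤ E) (i k : ℕ) :
    ((i : ℝ) + 1) ^ q * ((k : ℝ) + 1) ^ q * ‖∑' j, t i j * y j k‖ ≤ C * E * invSqSum := by
  have hi := pow_pos (base_pos i) q
  have hk := pow_pos (base_pos k) q
  have hC := nonneg_of_weight_bound ht
  have h := norm_tsum_mul_le (u := fun j => t i j) (v := fun j => y j k)
    (D := C / ((i : ℝ) + 1) ^ q) (E := E / ((k : ℝ) + 1) ^ q) (n := n) (by positivity)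
    (fun j => by
      rw [div_mul_eq_mul_div, le_div_iff₀' hi]
      exact ht i j)
    (fun j => by
      rw [le_div_iff₀ hk]
      refine le_trans (le_of_eq ?_) (hy j k)
      ring)
  rw [div_mul_div_comm, div_mul_eq_mul_div, le_div_iff₀' (by positivity)] at h
  exact h

lemma IsColumnMultiplier.isRapid_mul {t y : ℕ → ℕ → ℂ} (ht : IsColumnMultiplier t)
    (hy : IsRapid y) : IsRapid fun i k => ∑' j, t i j * y j k := by
  intro q
  obtain ⟨n, C, hC⟩ := ht q
  obtain ⟨E, hE⟩ := hy.exists_bound (n + 2) q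
  exact ⟨_, weight_mul_norm_tsum_le hC hE⟩

/-- If the product of `t` with each rapidly decreasing matrix is rapidly decreasing, then `t` is
a column multiplier. Otherwise some `(i c + 1) ^ q * |t (i c) (j c)|` are large compared with all
powers of `j c + 1`; the matrix with one entry in each column `c`, at the place `(j c, c)`,
then gives a contradiction. -/
lemma isColumnMultiplier_of_forall_isRapid {t : ℕ → ℕ → ℂ}
    (h : ∀ y, IsRapid y → ∃ z, IsRapid z ∧ ∀ i k, HasSum (fun j => t i j * y j k) (z i k)) :
    IsColumnMultiplier t := by
  intro q
  by_contra! hcon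
  choose i j hij using fun c : ℕ => hcon c (2 ^ c * c)
  let y : ℕ → ℕ → ℂ := fun b c => if b = j c then (((j c : ℂ) + 1) ^ c * 2 ^ c)⁻¹ else 0
  have hnorm : ∀ c, ‖y (j c) c‖ = (((j c : ℝ) + 1) ^ c * 2 ^ c)⁻¹ := by
    intro c
    simp only [y, if_true]
    rw [norm_inv, norm_mul, norm_natCast_add_one_pow]
    simp
  have hy : IsRapid y := by
    intro p
    have hlim := (tendsto_pow_const_div_const_pow_of_one_lt p (one_lt_two (α := ℝ))).comp
      (tendsto_add_atTop_nat 1)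
    have hev : ∀ᶠ c in atTop, ((j c : ℝ) + 1) ^ p * ((c : ℝ) + 1) ^ p *
        (((j c : ℝ) + 1) ^ c * 2 ^ c)⁻¹ ≤ 1 := by
      filter_upwards [eventually_ge_atTop p, hlim.eventually (Iio_mem_nhds one_half_pos)]
        with c hc hc'
      have h2 : (0 : ℝ) < 2 ^ (c + 1) := by positivity
      change (((c + 1 : ℕ) : ℝ)) ^ p / 2 ^ (c + 1) < 1 / 2 at hc'
      rw [div_lt_iff₀ h2, pow_succ] at hc'
      push_cast at hc'
      have h3 := base_pow_le hc (j c)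
      have h4 := pow_pos (base_pos (j c)) c
      rw [← div_eq_mul_inv, div_le_one (by positivity)]
      have : ((c : ℝ) + 1) ^ p ≤ 2 ^ c := by linarith
      gcongr
    obtain ⟨C, hC⟩ := exists_forall_le_of_eventually_le hev
    refine ⟨C, fun b c => ?_⟩
    by_cases hb : b = j c
    · rw [hb, hnorm]
      exact hC c
    · have : 0 ≤ C := le_trans (by positivity) (hC c)
      simpa [y, hb] using this
  obtain ⟨z, hz, hsum⟩ := h y hy
  obtain ⟨C, hC⟩ := hz q
  obtain ⟨c, hc⟩ := exists_nat_gt C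
  have hz1 : z (i c) c = t (i c) (j c) * y (j c) c :=
    (hsum (i c) c).unique (hasSum_single (j c) fun b hb => by simp [y, hb])
  have h1 := hC (i c) c
  rw [hz1, norm_mul, hnorm] at h1
  have h2 := hij c
  have h3 := pow_pos (base_pos (j c)) c
  have h4 : (0 : ℝ) < 2 ^ c := by positivity
  have h5 := one_le_base_pow c q
  have h6 : (c : ℝ) <
      ((i c : ℝ) + 1) ^ q * (‖t (i c) (j c)‖ * (((j c : ℝ) + 1) ^ c * 2 ^ c)⁻¹) := by
    rw [← mul_assoc, ← div_eq_mul_inv, lt_div_iff₀ (by positivity)]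
    linarith
  have h7 : ((i c : ℝ) + 1) ^ q * (‖t (i c) (j c)‖ * (((j c : ℝ) + 1) ^ c * 2 ^ c)⁻¹) ≤
      ((i c : ℝ) + 1) ^ q * ((c : ℝ) + 1) ^ q *
        (‖t (i c) (j c)‖ * (((j c : ℝ) + 1) ^ c * 2 ^ c)⁻¹) := by
    refine mul_le_mul_of_nonneg_right ?_ (by positivity)
    exact le_mul_of_one_le_right (by positivity) h5
  linarith

/-! ### The matrix of a double centralizer -/

namespace MultiplierAlgebra

/-- The map `L` of a double centralizer `(L, R)`. -/
def left (T : MultiplierAlgebra) : Smooth → Smooth := T.1.1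

/-- The map `R` of a double centralizer `(L, R)`. -/
def right (T : MultiplierAlgebra) : Smooth → Smooth := T.1.2

lemma opMul_left (T : MultiplierAlgebra) (x y : Smooth) :
    opMul x (left T y) = opMul (right T x) y := T.2 x y

lemma ext {T T' : MultiplierAlgebra} (h : ∀ y, left T y = left T' y)
    (h' : ∀ x, right T x = right T' x) : T = T' :=
  Subtype.ext (Prod.ext (funext h) (funext h'))

/-- The matrix `t` of a double centralizer `(L, R)`, with `L y = t y` and `R x = x t`. -/
def symbol (T : MultiplierAlgebra) (a b : ℕ) : ℂ := entry (right T (single 0 a 1)) 0 b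

lemma hasSum_entry_left (T : MultiplierAlgebra) (y : Smooth) (a k : ℕ) :
    HasSum (fun b => symbol T a b * entry y b k) (entry (left T y) a k) := by
  -- compare the `(0, k)` entries in `E_{0a} L(y) = R(E_{0a}) y`
  have h1 := hasSum_entry_opMul (right T (single 0 a 1)) y 0 k
  rw [← opMul_left] at h1
  have h2 := hasSum_entry_opMul (single 0 a 1) (left T y) 0 k
  have h3 : HasSum (fun j => entry (single 0 a 1) 0 j * entry (left T y) j k)
      (entry (left T y) a k) := by
    have := hasSum_single (f := fun j => entry (single 0 a 1) 0 j * entry (left T y) j k) a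
      fun j hj => by simp [entry_single, hj]
    simpa [entry_single] using this
  rwa [h2.unique h3] at h1

lemma hasSum_entry_right (T : MultiplierAlgebra) (x : Smooth) (i b : ℕ) :
    HasSum (fun a => entry x i a * symbol T a b) (entry (right T x) i b) := by
  -- compare the `(i, 0)` entries in `x L(E_{b0}) = R(x) E_{b0}`
  have h1 := hasSum_entry_opMul x (left T (single b 0 1)) i 0
  rw [opMul_left] at h1
  have h2 := hasSum_entry_opMul (right T x) (single b 0 1) i 0
  have h3 : HasSum (fun j => entry (right T x) i j * entry (single b 0 1) j 0)
      (entry (right T x) i b) := by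
    have := hasSum_single (f := fun j => entry (right T x) i j * entry (single b 0 1) j 0) b
      fun j hj => by simp [entry_single, hj]
    simpa [entry_single] using this
  have h4 : ∀ a, entry (left T (single b 0 1)) a 0 = symbol T a b := by
    intro a
    have := hasSum_single (f := fun j => symbol T a j * entry (single b 0 1) j 0) b
      fun j hj => by simp [entry_single, hj]
    refine (hasSum_entry_left T (single b 0 1) a 0).unique ?_
    simpa [entry_single] using this
  rw [h2.unique h3] at h1
  simpa only [h4] using h1

lemma ext_symbol {T T' : MultiplierAlgebra} (h : ∀ a b, symbol T a b = symbol T' a b) :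
    T = T' := by
  refine ext (fun y => Smooth.ext fun a k => ?_) (fun x => Smooth.ext fun i b => ?_)
  · have h1 := hasSum_entry_left T y a k
    simp only [h] at h1
    exact h1.unique (hasSum_entry_left T' y a k)
  · have h1 := hasSum_entry_right T x i b
    simp only [h] at h1
    exact h1.unique (hasSum_entry_right T' x i b)

lemma isColumnMultiplier_symbol (T : MultiplierAlgebra) : IsColumnMultiplier (symbol T) :=
  isColumnMultiplier_of_forall_isRapid fun y hy =>
    ⟨entry (left T (ofMatrix y hy)), isRapid_entry _, hasSum_entry_left T (ofMatrix y hy)⟩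

lemma isColumnMultiplier_symbol_swap (T : MultiplierAlgebra) :
    IsColumnMultiplier fun a b => symbol T b a :=
  isColumnMultiplier_of_forall_isRapid fun y hy =>
    ⟨fun a k => entry (right T (ofMatrix _ hy.swap)) k a, (isRapid_entry _).swap, fun a k => by
      simpa only [entry_ofMatrix, mul_comm] using hasSum_entry_right T (ofMatrix _ hy.swap) k a⟩

/-- The double centralizer with a given matrix. -/
def ofSymbol (t : ℕ → ℕ → ℂ) (ht : IsColumnMultiplier t)
    (ht' : IsColumnMultiplier fun a b => t b a) : MultiplierAlgebra :=
  ⟨(fun y => ofMatrix _ (ht.isRapid_mul (isRapid_entry y)),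
    fun x => ofMatrix _ (ht'.isRapid_mul (isRapid_entry x).swap).swap), by
    intro x y
    refine Smooth.ext fun i k => ?_
    have h1 := hasSum_entry_opMul x (ofMatrix _ (ht.isRapid_mul (isRapid_entry y))) i k
    have h2 := hasSum_entry_opMul
      (ofMatrix _ (ht'.isRapid_mul (isRapid_entry x).swap).swap) y i k
    refine h1.tsum_eq.symm.trans (Eq.trans ?_ h2.tsum_eq)
    simp only [entry_ofMatrix]
    obtain ⟨n, C, hC⟩ := ht 0
    obtain ⟨E, hE⟩ := (isRapid_entry y).exists_bound (n + 2) 0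
    obtain ⟨G, hG⟩ := (isRapid_entry x).exists_bound 0 2
    have hs : Summable (Function.uncurry fun a b => entry x i a * (t a b * entry y b k)) := by
      have hm := (summable_inv_add_one_sq.mul_left G).mul_of_nonneg
        (summable_inv_add_one_sq.mul_left (C * E)) (fun a => ?_) (fun b => ?_)
      · refine Summable.of_norm_bounded hm fun p => ?_
        have h3 := norm_mul_le_inv_sq (u := t p.1) (v := fun b => entry y b k)
          (nonneg_of_weight_bound hC) (by simpa using hC p.1)
          (fun b => by simpa using hE b k) p.2
        have h4 : ‖entry x i p.1‖ ≤ G * (((p.1 : ℝ) + 1) ^ 2)⁻¹ := by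
          rw [← div_eq_mul_inv, le_div_iff₀ (pow_pos (base_pos p.1) 2), mul_comm]
          simpa using hG i p.1
        rw [Function.uncurry_def, norm_mul]
        exact mul_le_mul h4 h3 (norm_nonneg _) ((norm_nonneg _).trans h4)
      · have : 0 ≤ G := le_trans (by positivity) (hG 0 0)
        positivity
      · have : 0 ≤ C * E := mul_nonneg (nonneg_of_weight_bound hC)
          (le_trans (by positivity) (hE 0 0))
        positivity
    -- `x (t y) = (x t) y`, as the double series converges absolutely
    calc ∑' a, entry x i a * ∑' b, t a b * entry y b k
        = ∑' a, ∑' b, entry x i a * (t a b * entry y b k) := by simp only [tsum_mul_left]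
      _ = ∑' b, ∑' a, entry x i a * (t a b * entry y b k) := hs.tsum_comm.symm
      _ = ∑' b, (∑' a, t a b * entry x i a) * entry y b k := by
          refine tsum_congr fun b => ?_
          rw [← tsum_mul_right]
          exact tsum_congr fun a => by ring⟩

lemma symbol_ofSymbol (t : ℕ → ℕ → ℂ) (ht ht') (a b : ℕ) :
    symbol (ofSymbol t ht ht') a b = t a b := by
  change ∑' c, t c b * entry (single 0 a 1) 0 c = t a b
  rw [tsum_eq_single a fun c hc => by simp [entry_single, hc]]
  simp [entry_single]

end MultiplierAlgebra
end NCSchwartz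

/-! ### The multiplier algebra as the limit of the spectrum -/

lemma pow_div_le_multiplierWeight (N n : ℕ) (p : ℕ × ℕ) :
    maxIdx p ^ N / minIdx p ^ n ≤ (multiplierWeight N).w n p := by
  change _ ≤ maxIdx p ^ ((N : ℝ) + 1 / ((n : ℝ) + 1)) * minIdx p ^ (-(n : ℝ))
  rw [Real.rpow_neg (minIdx_pos p).le, Real.rpow_natCast, ← div_eq_mul_inv, ← Real.rpow_natCast]
  have h : 0 < 1 / ((n : ℝ) + 1) := by positivity
  have h1 := Real.rpow_le_rpow_of_exponent_le (one_le_maxIdx p)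
    (show (N : ℝ) ≤ (N : ℝ) + 1 / ((n : ℝ) + 1) by linarith)
  have := minIdx_pos p
  gcongr

lemma multiplierWeight_le_pow_div (N n : ℕ) (p : ℕ × ℕ) :
    (multiplierWeight N).w n p ≤ maxIdx p ^ (N + 1) / minIdx p ^ n := by
  change maxIdx p ^ ((N : ℝ) + 1 / ((n : ℝ) + 1)) * minIdx p ^ (-(n : ℝ)) ≤ _
  rw [Real.rpow_neg (minIdx_pos p).le, Real.rpow_natCast, ← div_eq_mul_inv,
    ← Real.rpow_natCast (maxIdx p)]
  have h : 1 / ((n : ℝ) + 1) ≤ 1 := by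
    rw [div_le_one (by positivity)]
    have : (0 : ℝ) ≤ n := n.cast_nonneg
    linarith
  have h1 := Real.rpow_le_rpow_of_exponent_le (one_le_maxIdx p)
    (show (N : ℝ) + 1 / ((n : ℝ) + 1) ≤ ((N + 1 : ℕ) : ℝ) by push_cast; linarith)
  have := minIdx_pos p
  gcongr

lemma maxIdx_swap (p : ℕ × ℕ) : maxIdx p.swap = maxIdx p := by simp [maxIdx, max_comm]

lemma minIdx_swap (p : ℕ × ℕ) : minIdx p.swap = minIdx p := by simp [minIdx, min_comm]

lemma multiplierWeight_swap (N n : ℕ) (p : ℕ × ℕ) :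
    (multiplierWeight N).w n p.swap = (multiplierWeight N).w n p := by
  simp [multiplierWeight, maxIdx_swap, minIdx_swap]

lemma fst_le_maxIdx (p : ℕ × ℕ) : (p.1 : ℝ) + 1 ≤ maxIdx p := by simp [maxIdx]

lemma minIdx_le_snd (p : ℕ × ℕ) : minIdx p ≤ (p.2 : ℝ) + 1 := by simp [minIdx]

lemma summable_inv_sq_mul_inv_sq :
    Summable fun p : ℕ × ℕ => (((p.1 : ℝ) + 1) ^ 2)⁻¹ * (((p.2 : ℝ) + 1) ^ 2)⁻¹ :=
  summable_inv_add_one_sq.mul_of_nonneg summable_inv_add_one_sq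
    (fun _ => by positivity) (fun _ => by positivity)

lemma tsum_inv_sq_mul_inv_sq :
    ∑' p : ℕ × ℕ, (((p.1 : ℝ) + 1) ^ 2)⁻¹ * (((p.2 : ℝ) + 1) ^ 2)⁻¹ = invSqSum * invSqSum :=
  (summable_inv_add_one_sq.tsum_mul_tsum summable_inv_add_one_sq summable_inv_sq_mul_inv_sq).symm

namespace NCSchwartz

open RapidSeq SlowSeq Smooth

lemma isColumnMultiplier_of_summable {t : ℕ → ℕ → ℂ}
    (h : ∀ N, ∃ n, Summable fun p => (multiplierWeight N).w n p * ‖t p.1 p.2‖) :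
    IsColumnMultiplier t := by
  intro q
  obtain ⟨n, hn⟩ := h q
  refine ⟨n, ∑' p, (multiplierWeight q).w n p * ‖t p.1 p.2‖, fun i j => ?_⟩
  have h1 := hn.le_tsum (i, j) fun p _ =>
    mul_nonneg ((multiplierWeight q).pos n p).le (norm_nonneg _)
  have h2 := pow_div_le_multiplierWeight q n (i, j)
  have h3 := minIdx_pos (i, j)
  have h4 : maxIdx (i, j) ^ q ≤ (multiplierWeight q).w n (i, j) * minIdx (i, j) ^ n :=
    (div_le_iff₀ (pow_pos h3 n)).1 h2
  calc ((i : ℝ) + 1) ^ q * ‖t i j‖ ≤ maxIdx (i, j) ^ q * ‖t i j‖ := by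
        have := fst_le_maxIdx (i, j)
        gcongr
    _ ≤ (multiplierWeight q).w n (i, j) * minIdx (i, j) ^ n * ‖t i j‖ := by gcongr
    _ = (multiplierWeight q).w n (i, j) * ‖t i j‖ * minIdx (i, j) ^ n := by ring
    _ ≤ _ := by
        have h5 := minIdx_le_snd (i, j)
        have h6 : 0 ≤ (multiplierWeight q).w n (i, j) * ‖t i j‖ :=
          mul_nonneg ((multiplierWeight q).pos n _).le (norm_nonneg _)
        exact mul_le_mul h1 (pow_le_pow_left₀ h3.le h5 n) (pow_pos h3 n).le (h6.trans h1)

lemma summable_of_isColumnMultiplier {t : ℕ → ℕ → ℂ} (ht : IsColumnMultiplier t)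
    (ht' : IsColumnMultiplier fun a b => t b a) (N : ℕ) :
    ∃ n, Summable fun p : ℕ × ℕ => (multiplierWeight N).w n p * ‖t p.1 p.2‖ := by
  -- `max ^ (N + 3)` against the weight, which is at most `max ^ (N + 1)`, leaves `max ^ (-2)`
  obtain ⟨n₁, C₁, h₁⟩ := ht (N + 3)
  obtain ⟨n₂, C₂, h₂⟩ := ht' (N + 3)
  have hC₁ := nonneg_of_weight_bound h₁
  have hC₂ := nonneg_of_weight_bound h₂
  set n := max n₁ n₂
  set C := max C₁ C₂
  have hC : 0 ≤ C := hC₁.trans (le_max_left _ _)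
  have key : ∀ p : ℕ × ℕ, maxIdx p ^ (N + 3) * ‖t p.1 p.2‖ ≤ C * minIdx p ^ n := by
    rintro ⟨i, j⟩
    rcases le_total j i with hij | hij
    · have e1 : maxIdx (i, j) = (i : ℝ) + 1 := by simp [maxIdx, hij]
      have e2 : minIdx (i, j) = (j : ℝ) + 1 := by simp [minIdx, hij]
      rw [e1, e2]
      exact (h₁ i j).trans (mul_le_mul (le_max_left _ _) (base_pow_le (le_max_left _ _) j)
        (by positivity) hC)
    · have e1 : maxIdx (i, j) = (j : ℝ) + 1 := by simp [maxIdx, hij]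
      have e2 : minIdx (i, j) = (i : ℝ) + 1 := by simp [minIdx, hij]
      rw [e1, e2]
      exact (h₂ j i).trans (mul_le_mul (le_max_right _ _) (base_pow_le (le_max_right _ _) i)
        (by positivity) hC)
  refine ⟨n + 2, Summable.of_nonneg_of_le
    (fun p => mul_nonneg ((multiplierWeight N).pos _ p).le (norm_nonneg _)) (fun p => ?_)
    (summable_inv_sq_mul_inv_sq.mul_left C)⟩
  have h1 := maxIdx_pos p
  have h2 := minIdx_pos p
  refine (mul_le_mul_of_nonneg_right (multiplierWeight_le_pow_div N (n + 2) p)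
    (norm_nonneg _)).trans ?_
  rw [← mul_inv, ← mul_pow, ← maxIdx_mul_minIdx, ← div_eq_mul_inv, div_mul_eq_mul_div,
    div_le_div_iff₀ (by positivity) (by positivity)]
  calc maxIdx p ^ (N + 1) * ‖t p.1 p.2‖ * (maxIdx p * minIdx p) ^ 2
      = maxIdx p ^ (N + 3) * ‖t p.1 p.2‖ * minIdx p ^ 2 := by ring
    _ ≤ C * minIdx p ^ n * minIdx p ^ 2 := mul_le_mul_of_nonneg_right (key p) (by positivity)
    _ = C * minIdx p ^ (n + 2) := by ring

namespace MultiplierAlgebra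

/-- The inclusion of the multiplier algebra into the pairs of maps; it induces the topology. -/
def toMaps : MultiplierAlgebra →ₗ[ℂ]
    (UniformOnFun Smooth Smooth boundedSets) × (UniformOnFun Smooth Smooth boundedSets) where
  toFun T := (UniformOnFun.ofFun boundedSets (left T), UniformOnFun.ofFun boundedSets (right T))
  map_add' _ _ := rfl
  map_smul' _ _ := rfl

lemma isInducing_toMaps : IsInducing toMaps := ⟨rfl⟩

instance : IsTopologicalAddGroup MultiplierAlgebra := topologicalAddGroup_induced toMaps

instance : ContinuousConstSMul ℂ MultiplierAlgebra :=
  have : UniformContinuousConstSMul ℂ RapidSeq :=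
    uniformContinuousConstSMul_of_continuousConstSMul ℂ RapidSeq
  isInducing_toMaps.continuousConstSMul id fun {c x} => map_smul toMaps c x

lemma hasBasis_nhds_zero_uniformOnFun :
    (𝓝 (0 : UniformOnFun Smooth Smooth boundedSets)).HasBasis
      (fun BV : Set Smooth × Set Smooth => BV.1 ∈ boundedSets ∧ BV.2 ∈ 𝓝 0)
      fun BV => {f | ∀ x ∈ BV.1, UniformOnFun.toFun boundedSets f x ∈ BV.2} :=
  UniformOnFun.hasBasis_nhds_zero boundedSets ⟨∅, Bornology.isVonNBounded_empty ℂ _⟩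
    (directedOn_of_sup_mem fun _ _ => Bornology.IsVonNBounded.union)

lemma eventually_matNorm_lt {B : Set Smooth} (hB : Bornology.IsVonNBounded ℂ B) (q : ℕ) {r : ℝ}
    (hr : 0 < r) : ∀ᶠ T : MultiplierAlgebra in 𝓝 0,
      ∀ y ∈ B, matNorm q (left T y) < r ∧ matNorm q (right T y) < r := by
  have hV : (matNorm q).ball 0 r ∈ 𝓝 (0 : Smooth) :=
    Seminorm.ball_mem_nhds (continuous_matNorm q) hr
  have h0 := hasBasis_nhds_zero_uniformOnFun.mem_of_mem
    (show (B, (matNorm q).ball 0 r).1 ∈ boundedSets ∧ (B, (matNorm q).ball 0 r).2 ∈ 𝓝 0 from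
      ⟨hB, hV⟩)
  have h1 : Tendsto toMaps (𝓝 0) (𝓝 (0, 0)) := by
    have := isInducing_toMaps.continuous.tendsto 0
    rwa [map_zero] at this
  rw [nhds_prod_eq] at h1
  filter_upwards [(tendsto_fst.comp h1).eventually h0, (tendsto_snd.comp h1).eventually h0]
    with T hL hR y hy
  exact ⟨by simpa using! hL y hy, by simpa using! hR y hy⟩

/-- A double centralizer is sent to its matrix, as an element of the limit. -/
def toLimit : MultiplierAlgebra →ₗ[ℂ] multiplierSpectrum.limit where
  toFun T := CoechelonWeight.ofFun multiplierWeight multiplierWeight_mono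
    (fun p => symbol T p.1 p.2)
    (summable_of_isColumnMultiplier (isColumnMultiplier_symbol T)
      (isColumnMultiplier_symbol_swap T))
  map_add' _ _ := rfl
  map_smul' _ _ := rfl

lemma toLimit_apply (T : MultiplierAlgebra) (N : ℕ) (p : ℕ × ℕ) :
    ((toLimit T).1 N).1 p = symbol T p.1 p.2 := rfl

lemma bijective_toLimit : Function.Bijective toLimit := by
  constructor
  · intro T T' h
    refine ext_symbol fun a b => ?_
    exact congrArg (fun x : multiplierSpectrum.limit => (x.1 0).1 (a, b)) h
  · intro x
    have hx : ∀ N, ∃ n, Summable fun p : ℕ × ℕ =>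
        (multiplierWeight N).w n p * ‖(x.1 0).1 (p.1, p.2)‖ := by
      intro N
      obtain ⟨n, hn⟩ := (x.1 N).2
      refine ⟨n, hn.congr fun p => ?_⟩
      rw [CoechelonWeight.limit_apply _ multiplierWeight_mono x N]
    have hx' : ∀ N, ∃ n, Summable fun p : ℕ × ℕ =>
        (multiplierWeight N).w n p * ‖(x.1 0).1 (p.2, p.1)‖ := by
      intro N
      obtain ⟨n, hn⟩ := hx N
      refine ⟨n, ((Equiv.prodComm ℕ ℕ).summable_iff.2 hn).congr fun p => ?_⟩
      exact congrArg (· * _) (multiplierWeight_swap N n p)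
    refine ⟨ofSymbol (fun a b => (x.1 0).1 (a, b)) (isColumnMultiplier_of_summable hx)
      (isColumnMultiplier_of_summable (t := fun a b => (x.1 0).1 (b, a)) hx'), ?_⟩
    refine Subtype.ext (funext fun N => CoechelonWeight.Space.ext fun p => ?_)
    rw [toLimit_apply, symbol_ofSymbol, CoechelonWeight.limit_apply _ multiplierWeight_mono x N]

/-- Let `p` be a continuous seminorm on the step `N` and `u` its value on a matrix unit, divided
by the larger index to the power `N + 1`. Then `u` decays faster than all powers of the smaller
index, so that the multiples of the matrix units `E_{j0}` by `u (i, j) (j + 1) ^ 2`, `j ≤ i`, form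
a bounded set. The `(i, 0)` entry of the image under `L` is `t i j` times this factor, and
similarly for `R` and `i ≤ j`; this bounds `p t`. -/
lemma continuous_seminorm_comp_toLimit (N : ℕ) (p : Seminorm ℂ (multiplierWeight N).Space)
    (hp : Continuous p) : Continuous (p.comp ((LinearMap.proj (R := ℂ)
      (φ := fun N => (multiplierWeight N).Space) N).comp
        (multiplierSpectrum.limit.subtype.comp toLimit))) := by
  set u : ℕ × ℕ → ℝ := fun s => p ((multiplierWeight N).unit s) / maxIdx s ^ (N + 1) with hu
  have hu0 : ∀ s, 0 ≤ u s := fun s => div_nonneg (apply_nonneg p _) (pow_pos (maxIdx_pos s) _).le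
  have hdecay : ∀ n, ∃ C, ∀ s, minIdx s ^ n * u s ≤ C := by
    intro n
    obtain ⟨C, hC, h⟩ := LSSpace.exists_seminorm_emb_le
      (X := (multiplierWeight N).lsSpace) hp n
    refine ⟨C, fun s => ?_⟩
    have h1 := CoechelonWeight.seminorm_unit_le h s
    have h2 := multiplierWeight_le_pow_div N n s
    have h3 := pow_pos (maxIdx_pos s) (N + 1)
    have h4 := pow_pos (minIdx_pos s) n
    rw [hu, mul_div_assoc', div_le_iff₀ h3]
    calc minIdx s ^ n * p ((multiplierWeight N).unit s)
        ≤ minIdx s ^ n * (C * (maxIdx s ^ (N + 1) / minIdx s ^ n)) := by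
          gcongr
          exact h1.trans (by gcongr)
      _ = C * maxIdx s ^ (N + 1) := by field_simp
  -- the bounded set; the factor `minIdx ^ 2` makes the sum of the `|t s| * p (unit s)` converge
  let B : Set Smooth :=
    (Set.range fun s : {s : ℕ × ℕ // s.2 ≤ s.1} =>
      Smooth.single s.1.2 0 ((u s.1 * minIdx s.1 ^ 2 : ℝ) : ℂ)) ∪
    (Set.range fun s : {s : ℕ × ℕ // s.1 ≤ s.2} =>
      Smooth.single 0 s.1.1 ((u s.1 * minIdx s.1 ^ 2 : ℝ) : ℂ))
  have hnorm : ∀ s, ‖((u s * minIdx s ^ 2 : ℝ) : ℂ)‖ = u s * minIdx s ^ 2 := fun s => by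
    rw [Complex.norm_real,
      Real.norm_of_nonneg (mul_nonneg (hu0 s) (pow_nonneg (minIdx_pos s).le 2))]
  have hB : Bornology.IsVonNBounded ℂ B := by
    rw [Smooth.isVonNBounded_iff]
    intro q
    obtain ⟨C, hC⟩ := hdecay (q + 2)
    have hC0 : 0 ≤ C := le_trans (mul_nonneg (pow_pos (minIdx_pos (0, 0)) _).le (hu0 _)) (hC (0, 0))
    refine ⟨C, ?_⟩
    rintro _ (⟨⟨s, hs⟩, rfl⟩ | ⟨⟨s, hs⟩, rfl⟩) i j
    · rw [entry_single]
      by_cases h : i = s.2 ∧ j = 0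
      · have e : minIdx s = (s.2 : ℝ) + 1 := by simp [minIdx, hs]
        rw [if_pos h, h.1, h.2, hnorm]
        refine le_trans (le_of_eq ?_) (hC s)
        rw [e]
        push_cast
        ring
      · simpa [h] using hC0
    · rw [entry_single]
      by_cases h : i = 0 ∧ j = s.1
      · have e : minIdx s = (s.1 : ℝ) + 1 := by simp [minIdx, hs]
        rw [if_pos h, h.1, h.2, hnorm]
        refine le_trans (le_of_eq ?_) (hC s)
        rw [e]
        push_cast
        ring
      · simpa [h] using hC0
  have hZ := mul_self_nonneg invSqSum
  have hr : 0 < 1 / (invSqSum * invSqSum + 1) := by positivity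
  set r := 1 / (invSqSum * invSqSum + 1) with hrdef
  refine Seminorm.continuous' (r := 1) ?_
  filter_upwards [eventually_matNorm_lt hB (N + 3) hr] with T hT
  rw [Seminorm.mem_closedBall_zero]
  have hkey : ∀ s : ℕ × ℕ, maxIdx s ^ (N + 3) * (u s * minIdx s ^ 2 * ‖symbol T s.1 s.2‖) ≤ r := by
    intro s
    rcases le_total s.2 s.1 with hs | hs
    · have h1 := (hT _ (Or.inl ⟨⟨s, hs⟩, rfl⟩)).1
      have h2 := weight_mul_norm_entry_le (N + 3)
        (left T (Smooth.single s.2 0 ((u s * minIdx s ^ 2 : ℝ) : ℂ))) s.1 0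
      have h3 : entry (left T (Smooth.single s.2 0 ((u s * minIdx s ^ 2 : ℝ) : ℂ))) s.1 0 =
          symbol T s.1 s.2 * ((u s * minIdx s ^ 2 : ℝ) : ℂ) := by
        refine (hasSum_entry_left T _ s.1 0).unique ?_
        have := hasSum_single (f := fun b => symbol T s.1 b *
          entry (Smooth.single s.2 0 ((u s * minIdx s ^ 2 : ℝ) : ℂ)) b 0) s.2
          fun b hb => by simp [entry_single, hb]
        simpa only [entry_single, and_self, if_true] using this
      have e : maxIdx s = (s.1 : ℝ) + 1 := by simp [maxIdx, hs]
      rw [h3, norm_mul, hnorm] at h2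
      refine le_trans (le_of_eq ?_) (h2.trans h1.le)
      rw [e]
      push_cast
      ring
    · have h1 := (hT _ (Or.inr ⟨⟨s, hs⟩, rfl⟩)).2
      have h2 := weight_mul_norm_entry_le (N + 3)
        (right T (Smooth.single 0 s.1 ((u s * minIdx s ^ 2 : ℝ) : ℂ))) 0 s.2
      have h3 : entry (right T (Smooth.single 0 s.1 ((u s * minIdx s ^ 2 : ℝ) : ℂ))) 0 s.2 =
          ((u s * minIdx s ^ 2 : ℝ) : ℂ) * symbol T s.1 s.2 := by
        refine (hasSum_entry_right T _ 0 s.2).unique ?_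
        have := hasSum_single (f := fun a =>
          entry (Smooth.single 0 s.1 ((u s * minIdx s ^ 2 : ℝ) : ℂ)) 0 a * symbol T a s.2) s.1
          fun b hb => by simp [entry_single, hb]
        simpa only [entry_single, and_self, if_true] using this
      have e : maxIdx s = (s.2 : ℝ) + 1 := by simp [maxIdx, hs]
      rw [h3, norm_mul, hnorm] at h2
      refine le_trans (le_of_eq ?_) (h2.trans h1.le)
      rw [e]
      push_cast
      ring
  have hterm : ∀ s : ℕ × ℕ, ‖((toLimit T).1 N).1 s‖ * p ((multiplierWeight N).unit s) ≤
      r * ((((s.1 : ℝ) + 1) ^ 2)⁻¹ * (((s.2 : ℝ) + 1) ^ 2)⁻¹) := by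
    intro s
    have h1 := maxIdx_pos s
    have h2 := minIdx_pos s
    have h3 : p ((multiplierWeight N).unit s) = maxIdx s ^ (N + 1) * u s := by
      rw [hu]
      field_simp
    rw [h3, toLimit_apply, ← mul_inv, ← mul_pow, ← maxIdx_mul_minIdx, ← div_eq_mul_inv,
      le_div_iff₀ (by positivity)]
    refine le_trans (le_of_eq ?_) (hkey s)
    ring
  have hs := summable_inv_sq_mul_inv_sq.mul_left r
  have hs' : Summable fun s => ‖((toLimit T).1 N).1 s‖ * p ((multiplierWeight N).unit s) :=
    hs.of_nonneg_of_le (fun s => mul_nonneg (norm_nonneg _) (apply_nonneg p _)) hterm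
  calc p ((toLimit T).1 N)
      ≤ ∑' s, ‖((toLimit T).1 N).1 s‖ * p ((multiplierWeight N).unit s) :=
        CoechelonWeight.seminorm_le_tsum hp (fun _ => le_rfl) _ hs'
    _ ≤ ∑' s : ℕ × ℕ, r * ((((s.1 : ℝ) + 1) ^ 2)⁻¹ * (((s.2 : ℝ) + 1) ^ 2)⁻¹) :=
        hs'.tsum_le_tsum hterm hs
    _ = r * (invSqSum * invSqSum) := by rw [tsum_mul_left, tsum_inv_sq_mul_inv_sq]
    _ ≤ 1 := by
        rw [hrdef, one_div_mul_eq_div, div_le_one (by positivity)]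
        linarith

lemma continuous_toLimit : Continuous toLimit := by
  refine Continuous.subtype_mk (continuous_pi fun N => ?_) _
  exact (PolynormableSpace.withSeminorms ℂ (multiplierWeight N).Space).continuous_of_continuous_comp
    ((LinearMap.proj (R := ℂ) (φ := fun N => (multiplierWeight N).Space) N).comp
        (multiplierSpectrum.limit.subtype.comp toLimit))
    fun p => continuous_seminorm_comp_toLimit N p.1 p.2

/-- A bounded set of rapidly decreasing matrices is dominated by a rapidly decreasing sequence in
the row index. -/
lemma exists_majorant {Y : Set (ℕ → ℕ → ℂ)} (q : ℕ)
    (hY : ∀ n : ℕ, ∃ C, ∀ y ∈ Y, ∀ j k : ℕ, ((j : ℝ) + 1) ^ n * ((k : ℝ) + 1) ^ q * ‖y j k‖ ≤ C) :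
    ∃ β : ℕ → ℝ, (∀ j, 0 ≤ β j) ∧ (∀ n : ℕ, ∃ C, ∀ j : ℕ, ((j : ℝ) + 1) ^ n * β j ≤ C) ∧
      ∀ y ∈ Y, ∀ j k : ℕ, ((k : ℝ) + 1) ^ q * ‖y j k‖ ≤ β j := by
  have hbdd : ∀ j, BddAbove (Set.range fun z : Y × ℕ => ((z.2 : ℝ) + 1) ^ q * ‖z.1.1 j z.2‖) := by
    intro j
    obtain ⟨C, hC⟩ := hY 0
    refine ⟨C, ?_⟩
    rintro _ ⟨z, rfl⟩
    simpa using hC z.1.1 z.1.2 j z.2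
  refine ⟨fun j => ⨆ z : Y × ℕ, ((z.2 : ℝ) + 1) ^ q * ‖z.1.1 j z.2‖,
    fun j => Real.iSup_nonneg fun z => by positivity, fun n => ?_, fun y hy j k => ?_⟩
  · obtain ⟨C, hC⟩ := hY n
    refine ⟨max C 0, fun j => ?_⟩
    have hj := pow_pos (base_pos j) n
    rw [← le_div_iff₀' hj]
    refine Real.iSup_le (fun z => ?_) (by positivity)
    rw [le_div_iff₀' hj, ← mul_assoc]
    exact (hC z.1.1 z.1.2 j z.2).trans (le_max_left _ _)
  · exact le_ciSup (hbdd j) ((⟨y, hy⟩, k) : Y × ℕ)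

/-- On a bounded set of matrices `y`, the norms of the products `t y` are dominated by a
continuous seminorm of `t`. -/
lemma exists_seminorm_mul_le {Y : Set (ℕ → ℕ → ℂ)} (q : ℕ)
    (hY : ∀ n : ℕ, ∃ C, ∀ y ∈ Y, ∀ j k : ℕ, ((j : ℝ) + 1) ^ n * ((k : ℝ) + 1) ^ q * ‖y j k‖ ≤ C) :
    ∃ γ : ℕ × ℕ → ℝ, (∀ s, 0 ≤ γ s) ∧ (∀ n, ∃ C, ∀ s, γ s ≤ C * (multiplierWeight q).w n s) ∧
      ∀ (t : ℕ → ℕ → ℂ) (c : ℝ), 0 ≤ c → (∀ s : ℕ × ℕ, γ s * ‖t s.1 s.2‖ ≤ c) → ∀ y ∈ Y,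
        ∀ i k : ℕ, ((i : ℝ) + 1) ^ q * ((k : ℝ) + 1) ^ q * ‖∑' j, t i j * y j k‖ ≤
          c * invSqSum := by
  obtain ⟨β, hβ0, hβ, hβY⟩ := exists_majorant q hY
  refine ⟨fun s => ((s.1 : ℝ) + 1) ^ q * (((s.2 : ℝ) + 1) ^ 2 * β s.2),
    fun s => by have := hβ0 s.2; positivity, fun n => ?_, fun t c hc ht y hy i k => ?_⟩
  · obtain ⟨C, hC⟩ := hβ (n + 2)
    have hC0 : 0 ≤ C := le_trans (mul_nonneg (by positivity) (hβ0 0)) (hC 0)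
    refine ⟨C, fun s => ?_⟩
    have h1 := pow_div_le_multiplierWeight q n s
    have h2 := minIdx_pos s
    have h3 := maxIdx_pos s
    have h4 : ((s.2 : ℝ) + 1) ^ 2 * β s.2 ≤ C / minIdx s ^ n := by
      rw [le_div_iff₀' (by positivity), ← mul_assoc]
      refine le_trans ?_ (hC s.2)
      rw [pow_add]
      have h5 := pow_le_pow_left₀ h2.le (minIdx_le_snd s) n
      have := hβ0 s.2
      gcongr
    calc ((s.1 : ℝ) + 1) ^ q * (((s.2 : ℝ) + 1) ^ 2 * β s.2)
        ≤ maxIdx s ^ q * (C / minIdx s ^ n) :=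
          mul_le_mul (pow_le_pow_left₀ (by positivity) (fst_le_maxIdx s) q) h4
            (mul_nonneg (by positivity) (hβ0 _)) (by positivity)
      _ = C * (maxIdx s ^ q / minIdx s ^ n) := by ring
      _ ≤ _ := mul_le_mul_of_nonneg_left h1 hC0
  · have hi' := pow_pos (base_pos i) q
    have hk' := pow_pos (base_pos k) q
    have hle : ∀ j : ℕ, ‖t i j * y j k‖ ≤
        c / (((i : ℝ) + 1) ^ q * ((k : ℝ) + 1) ^ q) * (((j : ℝ) + 1) ^ 2)⁻¹ := by
      intro j
      have h1 := ht (i, j)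
      have h2 := hβY y hy j k
      rw [← div_eq_mul_inv, div_div, le_div_iff₀ (by positivity), norm_mul]
      calc ‖t i j‖ * ‖y j k‖ * (((i : ℝ) + 1) ^ q * ((k : ℝ) + 1) ^ q * ((j : ℝ) + 1) ^ 2)
          = ‖t i j‖ * ((i : ℝ) + 1) ^ q * ((j : ℝ) + 1) ^ 2 * (((k : ℝ) + 1) ^ q * ‖y j k‖) := by
            ring
        _ ≤ ‖t i j‖ * ((i : ℝ) + 1) ^ q * ((j : ℝ) + 1) ^ 2 * β j :=
            mul_le_mul_of_nonneg_left h2 (by positivity)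
        _ = ((i : ℝ) + 1) ^ q * (((j : ℝ) + 1) ^ 2 * β j) * ‖t i j‖ := by ring
        _ ≤ c := h1
    have h := tsum_of_norm_bounded (summable_inv_add_one_sq.mul_left
      (c / (((i : ℝ) + 1) ^ q * ((k : ℝ) + 1) ^ q))).hasSum hle
    rw [tsum_mul_left, ← invSqSum, div_mul_eq_mul_div, le_div_iff₀' (by positivity)] at h
    exact h

/-- The map `toLimit` as a linear equivalence. -/
def limitEquiv : MultiplierAlgebra ≃ₗ[ℂ] multiplierSpectrum.limit :=
  LinearEquiv.ofBijective toLimit bijective_toLimit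

lemma symbol_limitEquiv_symm (x : multiplierSpectrum.limit) (N : ℕ) (a b : ℕ) :
    symbol (limitEquiv.symm x) a b = (x.1 N).1 (a, b) :=
  congrArg (fun x : multiplierSpectrum.limit => (x.1 N).1 (a, b)) (limitEquiv.apply_symm_apply x)

lemma continuous_limit_proj (N : ℕ) :
    Continuous fun x : multiplierSpectrum.limit => (x.1 N : (multiplierWeight N).Space) :=
  (continuous_apply N).comp continuous_subtype_val

/-- Uniform convergence of `L y = t y` and `R y = y t` for `y` in a bounded set. -/
lemma eventually_matNorm_limitEquiv_symm_lt {B : Set Smooth} (hB : Bornology.IsVonNBounded ℂ B)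
    (q : ℕ) {r : ℝ} (hr : 0 < r) : ∀ᶠ x : multiplierSpectrum.limit in 𝓝 0, ∀ y ∈ B,
      matNorm q (left (limitEquiv.symm x) y) < r ∧
        matNorm q (right (limitEquiv.symm x) y) < r := by
  rw [Smooth.isVonNBounded_iff] at hB
  have hBn : ∀ n : ℕ, ∃ C, ∀ y ∈ B, ∀ j k : ℕ,
      ((j : ℝ) + 1) ^ n * ((k : ℝ) + 1) ^ q * ‖entry y j k‖ ≤ C ∧
      ((j : ℝ) + 1) ^ n * ((k : ℝ) + 1) ^ q * ‖entry y k j‖ ≤ C := by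
    intro n
    obtain ⟨C, hC⟩ := hB (n + q)
    refine ⟨C, fun y hy j k => ⟨(weight_le_weight_add j k (norm_nonneg _)).trans (hC y hy j k),
      (weight_le_weight_add j k (norm_nonneg _)).trans ?_⟩⟩
    rw [mul_comm (((j : ℝ) + 1) ^ (n + q))]
    exact hC y hy k j
  obtain ⟨γ, hγ0, hγ, hγB⟩ := exists_seminorm_mul_le (Y := entry '' B) q (fun n => by
    obtain ⟨C, hC⟩ := hBn n
    exact ⟨C, by rintro _ ⟨y, hy, rfl⟩ j k; exact (hC y hy j k).1⟩)
  obtain ⟨γ', hγ0', hγ', hγB'⟩ := exists_seminorm_mul_le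
    (Y := (fun y : Smooth => fun j k => entry y k j) '' B) q (fun n => by
      obtain ⟨C, hC⟩ := hBn n
      exact ⟨C, by rintro _ ⟨y, hy, rfl⟩ j k; exact (hC y hy j k).2⟩)
  obtain ⟨p, hpc, hp⟩ := (multiplierWeight q).exists_seminorm_coord_le γ hγ0 hγ
  obtain ⟨p', hpc', hp'⟩ := (multiplierWeight q).exists_seminorm_coord_le
    (fun s => γ' s.swap) (fun s => hγ0' _) (fun n => by
      obtain ⟨C, hC⟩ := hγ' n
      exact ⟨C, fun s => (hC s.swap).trans_eq (by rw [multiplierWeight_swap])⟩)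
  have hZ := invSqSum_nonneg
  have hδ : 0 < r / (invSqSum + 1) := by positivity
  have hsmall : ∀ p : Seminorm ℂ (multiplierWeight q).Space, Continuous p →
      ∀ᶠ x : multiplierSpectrum.limit in 𝓝 0, p (x.1 q) < r / (invSqSum + 1) := by
    intro p hpc
    have h := (hpc.comp (continuous_limit_proj q)).tendsto 0
    refine h.eventually (Iio_mem_nhds ?_)
    exact (map_zero p).trans_lt hδ
  have hfin : ∀ c : ℝ, 0 ≤ c → c < r / (invSqSum + 1) → c * invSqSum < r := by
    intro c hc h
    rw [lt_div_iff₀ (by positivity)] at h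
    linarith
  filter_upwards [hsmall p hpc, hsmall p' hpc'] with x hx hx' y hy
  constructor
  · refine lt_of_le_of_lt (matNorm_le_iff.2 fun i k => ?_) (hfin _ (apply_nonneg p (x.1 q)) hx)
    rw [← (hasSum_entry_left _ y i k).tsum_eq]
    refine hγB (symbol (limitEquiv.symm x)) _ (apply_nonneg p _) (fun s => ?_) _ ⟨y, hy, rfl⟩ i k
    rw [symbol_limitEquiv_symm x q]
    exact hp s (x.1 q)
  · refine lt_of_le_of_lt (matNorm_le_iff.2 fun k i => ?_) (hfin _ (apply_nonneg p' (x.1 q)) hx')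
    rw [← (hasSum_entry_right _ y k i).tsum_eq, mul_comm (((k : ℝ) + 1) ^ q)]
    have h := hγB' (fun a b => symbol (limitEquiv.symm x) b a) (p' (x.1 q)) (apply_nonneg p' _)
      (fun s => by
        rw [symbol_limitEquiv_symm x q]
        exact hp' s.swap (x.1 q)) _ ⟨y, hy, rfl⟩ i k
    simpa only [mul_comm] using h

lemma continuous_limitEquiv_symm : Continuous limitEquiv.symm := by
  refine isInducing_toMaps.continuous_iff.2 ?_
  refine continuous_of_continuousAt_zero (toMaps.comp limitEquiv.symm.toLinearMap) ?_
  rw [ContinuousAt, map_zero, Prod.zero_eq_mk, nhds_prod_eq]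
  refine Tendsto.prodMk ?_ ?_
  · refine hasBasis_nhds_zero_uniformOnFun.tendsto_right_iff.2 ?_
    rintro ⟨B, V⟩ ⟨hB, hV⟩
    obtain ⟨q, r, hr, h⟩ := exists_matNorm_ball_subset hV
    filter_upwards [eventually_matNorm_limitEquiv_symm_lt hB q hr] with x hx y hy
    exact h _ (hx y hy).1
  · refine hasBasis_nhds_zero_uniformOnFun.tendsto_right_iff.2 ?_
    rintro ⟨B, V⟩ ⟨hB, hV⟩
    obtain ⟨q, r, hr, h⟩ := exists_matNorm_ball_subset hV
    filter_upwards [eventually_matNorm_limitEquiv_symm_lt hB q hr] with x hx y hy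
    exact h _ (hx y hy).2

/-- The multiplier algebra is the limit of the spectrum of weighted spaces of matrices. -/
def limitEquivL : MultiplierAlgebra ≃L[ℂ] multiplierSpectrum.limit where
  toLinearEquiv := limitEquiv
  continuous_toFun := continuous_toLimit
  continuous_invFun := continuous_limitEquiv_symm

end MultiplierAlgebra
end NCSchwartz

end

theorem mainTheorem7 :
    HasDualInterpolationBig NCSchwartz.MultiplierAlgebra ∧
      ¬ HasDualInterpolationSmall NCSchwartz.MultiplierAlgebra := by
  refine ⟨⟨multiplierSpectrum, ⟨CoechelonWeight.isReduced_spectrum _ multiplierWeight_mono,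
    ⟨NCSchwartz.MultiplierAlgebra.limitEquivL⟩⟩, dualInterpolationBig_multiplierSpectrum⟩, ?_⟩
  rintro ⟨S, ⟨hS, ⟨e⟩⟩, hD⟩
  exact not_dualInterpolationSmall_of_equiv hS
    (e.symm.trans NCSchwartz.MultiplierAlgebra.limitEquivL) hD
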